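/- Let $\ell>0$ and $\mathcal I=[0,\ell]$. Let $\mathcal F$ be the Fourier–Plancherel operator of $L^2(\mathbb R)$, $(\mathcal F\psi)(x)=(2\pi)^{-1/2}\int_{\mathbb R} e^{-ixt}\psi(t)\,dt$, let $\mathsf Q_{\mathbb R}(Y)$ be multiplication by the characteristic function $\chi_Y$ on $L^2(\mathbb R)$, and let $\mathsf P_{\mathbb R}(Y)=\mathcal F^*\mathsf Q_{\mathbb R}(Y)\mathcal F$ for Borel sets $Y\subseteq\mathbb R$. Let $U:L^2(\mathcal I)\to L^2(\mathbb R)$ be the isometry extending functions by zero, and let $\mathsf P(Y)=U^*\mathsf P_{\mathbb R}(Y)U$ be the momentum POVM on $L^2(\mathcal I)$. For a normalized POVM $\mathsf E$ on $\mathbb R$ with values in the bounded operators of a Hilbert space $\mathcal H$, write $\mathsf E_{\psi,\varphi}(Y)=\langle\psi|\mathsf E(Y)\varphi\rangle$. For $k\in\mathbb N=\{0,1,2,\dots\}$ the moment operator $\tilde{\mathsf E}[k]$ has domain $\{\varphi\in\mathcal H \mid \int x^{2k}\,d\mathsf E_{\varphi,\varphi}(x)<\infty\}$ and is determined there by $\langle\psi|\tilde{\mathsf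 E}[k]\varphi\rangle=\int x^k\,d\mathsf E_{\psi,\varphi}(x)$ for all $\psi\in\mathcal H$. Call $\mathsf E$ variance-free if, for every $k\in\mathbb N$, the domain of $\tilde{\mathsf E}[k]$ is dense and $$\int x^{2k}\,d\mathsf E_{\psi,\varphi}(x)=\langle\tilde{\mathsf E}[k]\psi|\tilde{\mathsf E}[k]\varphi\rangle\qquad\text{for all }\psi,\varphi\text{ in the domain of }\tilde{\mathsf E}[k].$$ Let $P_0=-i\,d/dx$ in $L^2(\mathcal I)$, with domain the absolutely continuous functions $\varphi$ on $\mathcal I$ such that $\varphi'\in L^2(\mathcal I)$ and $\varphi(0)=\varphi(\ell)=0$. Let $P_0^n$ denote its powers on their natural domains ($P_0^0=I$). For $n\ge1$ let $$H^n(\mathcal I)=\{\varphi\in C^{n-1}(\mathcal I)\mid \varphi^{(n-1)}\text{ is absolutely continuous and }\varphi^{(n)}\in L^2(\mathcal I)\}.$$ Then: 1. $\tilde{\mathsf P}[n]=P_0^n$ for every $n\in\mathbb N$ (equality of operators, including domains); 2. for every $n\ge 1$ the domain of this operator is $\{\varphi\in H^n(\mathcal I)\mid \varphi^{(k)}(0)=\varphi^{(k)}(\ell)=0,\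 k=0,1,\dots,n-1\}$; 3. $\mathsf P$ is variance-free. -/

import Mathlib

open MeasureTheory
open scoped InnerProductSpace ENNReal NNReal

/-- A normalized positive operator valued measure on a measurable space `Ω`, with values in the
bounded operators of a complex Hilbert space `H`; it is `σ`-additive in the strong operator
topology.  As for Mathlib's vector measures, the value on non-measurable sets is `0` by
convention. -/
structure POVM (Ω : Type*) [MeasurableSpace Ω] (H : Type*) [NormedAddCommGroup H]
    [InnerProductSpace ℂ H] where
  toFun : Set Ω → H →L[ℂ] H
  isPositive : ∀ X, MeasurableSet X → (toFun X).IsPositive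
  not_measurable : ∀ X, ¬ MeasurableSet X → toFun X = 0
  hasSum : ∀ X : ℕ → Set Ω, (∀ i, MeasurableSet (X i)) → Pairwise (Function.onFun Disjoint X) →
    ∀ φ : H, HasSum (fun i => toFun (X i) φ) (toFun (⋃ i, X i) φ)
  univ_eq_one : toFun Set.univ = 1

namespace POVM

section General

variable {Ω : Type*} [MeasurableSpace Ω] {H : Type*} [NormedAddCommGroup H]
  [InnerProductSpace ℂ H]

theorem empty_apply (E : POVM Ω H) (φ : H) : E.toFun ∅ φ = 0 := by
  have h := E.hasSum (fun _ => ∅) (fun _ => MeasurableSet.empty)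
    (fun i j _ => by simp [Function.onFun]) φ
  have h0 := h.summable.tendsto_atTop_zero
  exact tendsto_nhds_unique tendsto_const_nhds h0

/-- The complex measure `E_{ψ,φ}(X) = ⟪ψ, E(X) φ⟫`. -/
noncomputable def scalarMeasure (E : POVM Ω H) (ψ φ : H) : ComplexMeasure Ω where
  measureOf' X := ⟪ψ, E.toFun X φ⟫_ℂ
  empty' := by simp [E.empty_apply]
  not_measurable' X hX := by simp [E.not_measurable X hX]
  m_iUnion' X hX hd := (E.hasSum X hX hd φ).mapL (innerSL ℂ ψ)

theorem scalarMeasure_apply (E : POVM Ω H) (ψ φ : H) (X : Set Ω) :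
    E.scalarMeasure ψ φ X = ⟪ψ, E.toFun X φ⟫_ℂ := rfl

theorem scalarMeasure_add_left (E : POVM Ω H) (ψ₁ ψ₂ φ : H) :
    E.scalarMeasure (ψ₁ + ψ₂) φ = E.scalarMeasure ψ₁ φ + E.scalarMeasure ψ₂ φ := by
  ext X hX
  simp [scalarMeasure_apply]

theorem scalarMeasure_add_right (E : POVM Ω H) (ψ φ₁ φ₂ : H) :
    E.scalarMeasure ψ (φ₁ + φ₂) = E.scalarMeasure ψ φ₁ + E.scalarMeasure ψ φ₂ := by
  ext X hX
  simp [scalarMeasure_apply]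

theorem scalarMeasure_smul_left (E : POVM Ω H) (c : ℂ) (ψ φ : H) :
    E.scalarMeasure (c • ψ) φ = (starRingEnd ℂ c) • E.scalarMeasure ψ φ := by
  ext X hX
  simp [scalarMeasure_apply, mul_comm]

theorem scalarMeasure_smul_right (E : POVM Ω H) (c : ℂ) (ψ φ : H) :
    E.scalarMeasure ψ (c • φ) = c • E.scalarMeasure ψ φ := by
  ext X hX
  simp [scalarMeasure_apply]

/-- The form inequality `2 |⟪ψ, E(X) φ⟫| ≤ ⟪ψ, E(X) ψ⟫ + ⟪φ, E(X) φ⟫`. -/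
theorem two_mul_norm_scalarMeasure_le (E : POVM Ω H) (ψ φ : H) (X : Set Ω) :
    2 * ‖E.scalarMeasure ψ φ X‖ ≤ ‖E.scalarMeasure ψ ψ X‖ + ‖E.scalarMeasure φ φ X‖ := by
  by_cases hX : MeasurableSet X
  swap
  · simp [scalarMeasure_apply, E.not_measurable X hX]
  have hA := E.isPositive X hX
  simp only [scalarMeasure_apply]
  set A := E.toFun X
  obtain ⟨w, hw, hz⟩ : ∃ w : ℂ, ‖w‖ = 1 ∧ w * ⟪ψ, A φ⟫_ℂ = (‖⟪ψ, A φ⟫_ℂ‖ : ℂ) := by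
    by_cases h0 : ⟪ψ, A φ⟫_ℂ = 0
    · exact ⟨1, by simp, by simp [h0]⟩
    · have hn : (‖⟪ψ, A φ⟫_ℂ‖ : ℂ) ≠ 0 := by simpa using h0
      refine ⟨(‖⟪ψ, A φ⟫_ℂ‖ : ℂ) / ⟪ψ, A φ⟫_ℂ, ?_, ?_⟩
      · rw [norm_div, Complex.norm_real, norm_norm, div_self (by simpa using h0)]
      · field_simp
  have h1 := hA.re_inner_nonneg_right (ψ - w • φ)
  have hsym : ⟪φ, A ψ⟫_ℂ = starRingEnd ℂ ⟪ψ, A φ⟫_ℂ := by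
    rw [inner_conj_symm, hA.inner_left_eq_inner_right]
  have hww : starRingEnd ℂ w * w = 1 := by
    rw [mul_comm, Complex.mul_conj, Complex.normSq_eq_norm_sq, hw]; simp
  have h2 : ⟪ψ - w • φ, A (ψ - w • φ)⟫_ℂ
      = ⟪ψ, A ψ⟫_ℂ - w * ⟪ψ, A φ⟫_ℂ - starRingEnd ℂ (w * ⟪ψ, A φ⟫_ℂ) + ⟪φ, A φ⟫_ℂ := by
    simp only [map_sub, map_smul, inner_sub_left, inner_sub_right, inner_smul_left,
      inner_smul_right, hsym, map_mul]
    linear_combination ⟪φ, A φ⟫_ℂ * hww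
  rw [h2, hz] at h1
  simp only [Complex.conj_ofReal, map_add, map_sub, RCLike.re_to_complex, Complex.ofReal_re] at h1
  have h3 := Complex.re_le_norm ⟪ψ, A ψ⟫_ℂ
  have h4 := Complex.re_le_norm ⟪φ, A φ⟫_ℂ
  linarith

theorem enorm_scalarMeasure_le (E : POVM Ω H) (ψ φ : H) (X : Set Ω) :
    ‖E.scalarMeasure ψ φ X‖ₑ ≤
      (E.scalarMeasure ψ ψ).variation X + (E.scalarMeasure φ φ).variation X := by
  refine le_trans ?_ (add_le_add (VectorMeasure.enorm_measure_le_variation _ X)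
    (VectorMeasure.enorm_measure_le_variation _ X))
  have h := E.two_mul_norm_scalarMeasure_le ψ φ X
  have h' : ‖E.scalarMeasure ψ φ X‖₊ ≤ ‖E.scalarMeasure ψ ψ X‖₊ + ‖E.scalarMeasure φ φ X‖₊ := by
    rw [← NNReal.coe_le_coe]
    push_cast
    have := norm_nonneg (E.scalarMeasure ψ φ X)
    linarith
  simpa [enorm] using (ENNReal.coe_le_coe.mpr h')

theorem variation_scalarMeasure_le (E : POVM Ω H) (ψ φ : H) :
    (E.scalarMeasure ψ φ).variation ≤
      (E.scalarMeasure ψ ψ).variation + (E.scalarMeasure φ φ).variation :=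
  VectorMeasure.variation_le_of_forall_enorm_le fun X _ => by
    simpa using E.enorm_scalarMeasure_le ψ φ X

theorem variation_add_add_le (E : POVM Ω H) (φ₁ φ₂ : H) :
    (E.scalarMeasure (φ₁ + φ₂) (φ₁ + φ₂)).variation ≤
      (3 : ℝ≥0∞) • ((E.scalarMeasure φ₁ φ₁).variation + (E.scalarMeasure φ₂ φ₂).variation) := by
  refine VectorMeasure.variation_le_of_forall_enorm_le fun X _ => ?_
  rw [scalarMeasure_add_left, scalarMeasure_add_right, scalarMeasure_add_right]
  have h11 := VectorMeasure.enorm_measure_le_variation (E.scalarMeasure φ₁ φ₁) X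
  have h22 := VectorMeasure.enorm_measure_le_variation (E.scalarMeasure φ₂ φ₂) X
  have h12 := E.enorm_scalarMeasure_le φ₁ φ₂ X
  have h21 := E.enorm_scalarMeasure_le φ₂ φ₁ X
  simp only [_root_.add_apply, Measure.smul_apply, Measure.add_apply, smul_eq_mul]
  calc _ ≤ _ := enorm_add_le _ _
    _ ≤ _ := add_le_add (enorm_add_le _ _) (enorm_add_le _ _)
    _ ≤ _ := add_le_add (add_le_add h11 h12) (add_le_add h21 h22)
    _ = _ := by ring

/-- The square integrability domain `{φ | |f|² is E_{φ,φ}-integrable}`. -/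
noncomputable def sqDomain (E : POVM Ω H) (f : Ω → ℝ) : Submodule ℂ H where
  carrier := {φ | (E.scalarMeasure φ φ).Integrable fun x => f x ^ 2}
  zero_mem' := by
    have : E.scalarMeasure 0 0 = 0 := by ext X _; simp [scalarMeasure_apply]
    simp [this]
  add_mem' {φ₁ φ₂} h₁ h₂ :=
    ((h₁.add_measure h₂).smul_measure (by simp)).mono_measure (E.variation_add_add_le φ₁ φ₂)
  smul_mem' c φ h := by
    have : E.scalarMeasure (c • φ) (c • φ)
        = (starRingEnd ℂ c * c) • E.scalarMeasure φ φ := by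
      rw [scalarMeasure_smul_left, scalarMeasure_smul_right, smul_smul]
    simp only [Set.mem_ofPred_eq, this, VectorMeasure.Integrable]
    rw [VectorMeasure.variation_smul]
    exact h.smul_measure_nnreal

theorem mem_sqDomain (E : POVM Ω H) (f : Ω → ℝ) (φ : H) :
    φ ∈ E.sqDomain f ↔ (E.scalarMeasure φ φ).Integrable fun x => f x ^ 2 := Iff.rfl

/-- The total variation of `E_{ψ,ψ}` is at most `‖ψ‖²`. -/
theorem variation_self_univ_le (E : POVM Ω H) (ψ : H) :
    (E.scalarMeasure ψ ψ).variation Set.univ ≤ ENNReal.ofReal (‖ψ‖ ^ 2) := by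
  by_contra hcon
  obtain ⟨P, -, hd, hm, hlt⟩ :=
    VectorMeasure.exists_lt_sum_of_lt_variation _ MeasurableSet.univ (not_le.mp hcon)
  have hval : ∀ X, MeasurableSet X → E.scalarMeasure ψ ψ X = ((⟪ψ, E.toFun X ψ⟫_ℂ).re : ℂ) ∧
      0 ≤ (⟪ψ, E.toFun X ψ⟫_ℂ).re := fun X hX => by
    have h := (E.isPositive X hX).inner_nonneg_right ψ
    rw [Complex.le_def] at h
    exact ⟨Complex.ext rfl (by simpa [scalarMeasure_apply] using h.2.symm), by simpa using h.1⟩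
  have hU : MeasurableSet (⋃ p ∈ P, p) := P.measurableSet_biUnion hm
  have hsum : ∑ p ∈ P, E.scalarMeasure ψ ψ p = E.scalarMeasure ψ ψ (⋃ p ∈ P, p) :=
    (VectorMeasure.of_biUnion_finset hd hm).symm
  have hsum' : ∑ p ∈ P, ‖E.scalarMeasure ψ ψ p‖ₑ
      = ENNReal.ofReal (⟪ψ, E.toFun (⋃ p ∈ P, p) ψ⟫_ℂ).re := by
    have h1 : (⟪ψ, E.toFun (⋃ p ∈ P, p) ψ⟫_ℂ).re = ∑ p ∈ P, (⟪ψ, E.toFun p ψ⟫_ℂ).re := by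
      have := congrArg Complex.re hsum
      rw [Complex.re_sum] at this
      exact this.symm
    rw [h1, ENNReal.ofReal_sum_of_nonneg fun p hp => (hval p (hm p hp)).2]
    refine Finset.sum_congr rfl fun p hp => ?_
    rw [(hval p (hm p hp)).1, ← ofReal_norm, Complex.norm_real, Real.norm_of_nonneg
      (hval p (hm p hp)).2]
  have hle : (⟪ψ, E.toFun (⋃ p ∈ P, p) ψ⟫_ℂ).re ≤ ‖ψ‖ ^ 2 := by
    have h1 := VectorMeasure.of_add_of_sdiff (v := E.scalarMeasure ψ ψ) hU MeasurableSet.univ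
      (Set.subset_univ _)
    have h2 := congrArg Complex.re h1
    have h3 : (E.scalarMeasure ψ ψ Set.univ).re = ‖ψ‖ ^ 2 := by
      rw [scalarMeasure_apply, E.univ_eq_one, one_apply_eq_self]
      exact inner_self_eq_norm_sq (𝕜 := ℂ) ψ
    rw [Complex.add_re, h3] at h2
    have h4 := (hval _ (MeasurableSet.univ.diff hU)).2
    simp only [scalarMeasure_apply] at h2
    linarith
  rw [hsum'] at hlt
  exact absurd (ENNReal.ofReal_le_ofReal hle) (not_le.mpr hlt)

theorem smul_variation_le (E : POVM Ω H) (ψ φ : H) (c : ℝ≥0) (X : Set Ω) :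
    (c : ℝ≥0∞) * (E.scalarMeasure ψ φ).variation X ≤
      (E.scalarMeasure ψ ψ).variation X
        + (c : ℝ≥0∞) ^ 2 * (E.scalarMeasure φ φ).variation X := by
  have h := E.variation_scalarMeasure_le ψ (((c : ℝ) : ℂ) • φ) X
  rw [scalarMeasure_smul_left, scalarMeasure_smul_right, scalarMeasure_smul_right, smul_smul,
    VectorMeasure.variation_smul, Measure.add_apply, VectorMeasure.variation_smul] at h
  simp only [Measure.smul_apply, ENNReal.smul_def, smul_eq_mul, nnnorm_mul, RCLike.nnnorm_conj,
    Complex.nnnorm_real, NNReal.nnnorm_eq, ENNReal.coe_mul] at h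
  rwa [pow_two]

theorem lintegral_variation_le (E : POVM Ω H) (ψ φ : H) (f : Ω → ℝ≥0∞) :
    ∫⁻ x, f x ∂(E.scalarMeasure ψ φ).variation ≤
      (E.scalarMeasure ψ ψ).variation Set.univ
        + ∫⁻ x, f x ^ 2 ∂(E.scalarMeasure φ φ).variation := by
  rw [lintegral_eq_nnreal]
  refine iSup₂_le fun s hs => ?_
  rw [SimpleFunc.map_lintegral]
  calc _ ≤ ∑ c ∈ s.range, ((E.scalarMeasure ψ ψ).variation (s ⁻¹' {c})
          + (c : ℝ≥0∞) ^ 2 * (E.scalarMeasure φ φ).variation (s ⁻¹' {c})) :=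
        Finset.sum_le_sum fun c _ => E.smul_variation_le ψ φ c _
    _ = (E.scalarMeasure ψ ψ).variation Set.univ
        + (s.map fun c : ℝ≥0 => (c : ℝ≥0∞) ^ 2).lintegral (E.scalarMeasure φ φ).variation := by
        rw [Finset.sum_add_distrib, SimpleFunc.sum_range_measure_preimage_singleton,
          SimpleFunc.map_lintegral]
    _ ≤ _ := by
        rw [← SimpleFunc.lintegral_eq_lintegral]
        gcongr with x
        exact pow_le_pow_left' (hs x) 2

theorem lintegral_sq_lt_top (E : POVM Ω H) {f : Ω → ℝ} {φ : H} (hφ : φ ∈ E.sqDomain f) :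
    ∫⁻ x, ‖f x‖ₑ ^ 2 ∂(E.scalarMeasure φ φ).variation < ∞ := by
  simpa [HasFiniteIntegral, enorm_pow] using ((E.mem_sqDomain f φ).mp hφ).2

/-- `f` is integrable with respect to `E_{ψ,φ}` for all `ψ` if `φ` is in the square integrability
domain. -/
theorem integrable_of_mem_sqDomain (E : POVM Ω H) {f : Ω → ℝ} (hf : Measurable f) {φ : H}
    (hφ : φ ∈ E.sqDomain f) (ψ : H) : (E.scalarMeasure ψ φ).Integrable f := by
  refine ⟨hf.aestronglyMeasurable, (E.lintegral_variation_le ψ φ _).trans_lt ?_⟩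
  exact ENNReal.add_lt_top.mpr ⟨(E.variation_self_univ_le ψ).trans_lt ENNReal.ofReal_lt_top,
    E.lintegral_sq_lt_top hφ⟩

/-- `f²` is integrable with respect to `E_{ψ,φ}` if both `ψ` and `φ` are in the square
integrability domain. -/
theorem integrable_sq_of_mem_sqDomain (E : POVM Ω H) {f : Ω → ℝ} {ψ φ : H}
    (hψ : ψ ∈ E.sqDomain f) (hφ : φ ∈ E.sqDomain f) :
    (E.scalarMeasure ψ φ).Integrable fun x => f x ^ 2 :=
  (Integrable.add_measure ((E.mem_sqDomain f ψ).mp hψ)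
    ((E.mem_sqDomain f φ).mp hφ)).mono_measure (E.variation_scalarMeasure_le ψ φ)

theorem integral_smul_complexMeasure {μ : ComplexMeasure Ω} {f : Ω → ℝ} (hf : μ.Integrable f)
    (c : ℂ) : ∫ᵛ x, f x ∂•(c • μ) = c * ∫ᵛ x, f x ∂•μ := by
  have key : (c • μ).transpose (ContinuousLinearMap.lsmul ℝ ℝ)
      = μ.transpose ((ContinuousLinearMap.compL ℝ ℂ ℂ ℂ (ContinuousLinearMap.mul ℝ ℂ c)) ∘L
        (ContinuousLinearMap.lsmul ℝ ℝ)) := by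
    ext X hX
    change (1 : ℝ) • (c • μ X) = c * ((1 : ℝ) • μ X)
    simp
  have h := VectorMeasure.continuousLinearMap_apply_integral (μ := μ)
    (B := ContinuousLinearMap.lsmul ℝ ℝ) (C := ContinuousLinearMap.mul ℝ ℂ c) hf
  rw [ContinuousLinearMap.mul_apply'] at h
  rw [h]
  have hf' : (c • μ).Integrable f := by
    rw [VectorMeasure.Integrable, VectorMeasure.variation_smul]
    exact hf.smul_measure_nnreal
  rw [VectorMeasure.integral_eq_setToFun_transpose hf',
    VectorMeasure.integral_eq_setToFun_transpose hf]
  simp only [key]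

/-- For `φ` in the square integrability domain there is a unique vector `η` with
`⟪ψ, η⟫ = ∫ f dE_{ψ,φ}` for all `ψ`; this is the existence part. -/
theorem exists_sqIntegral [CompleteSpace H] (E : POVM Ω H) {f : Ω → ℝ} (hf : Measurable f) {φ : H}
    (hφ : φ ∈ E.sqDomain f) :
    ∃ η : H, ∀ ψ : H, ⟪ψ, η⟫_ℂ = ∫ᵛ x, f x ∂•(E.scalarMeasure ψ φ) := by
  have hint := E.integrable_of_mem_sqDomain hf hφ
  let L : H →ₗ[ℂ] ℂ :=
    { toFun := fun ψ => starRingEnd ℂ (∫ᵛ x, f x ∂•(E.scalarMeasure ψ φ))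
      map_add' := fun ψ₁ ψ₂ => by
        rw [scalarMeasure_add_left, VectorMeasure.integral_add_vectorMeasure (hint ψ₁) (hint ψ₂),
          map_add]
      map_smul' := fun c ψ => by
        rw [scalarMeasure_smul_left, integral_smul_complexMeasure (hint ψ)]
        simp }
  have hL : ∀ ψ, L ψ = starRingEnd ℂ (∫ᵛ x, f x ∂•(E.scalarMeasure ψ φ)) := fun _ => rfl
  set C : ℝ := (∫⁻ x, ‖f x‖ₑ ^ 2 ∂(E.scalarMeasure φ φ).variation).toReal with hC
  have hb : ∀ ψ, ‖L ψ‖ ≤ ‖ψ‖ ^ 2 + C := fun ψ => by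
    rw [hL, RCLike.norm_conj]
    have hfin : ENNReal.ofReal (‖ψ‖ ^ 2)
        + ∫⁻ x, ‖f x‖ₑ ^ 2 ∂(E.scalarMeasure φ φ).variation ≠ ∞ :=
      (ENNReal.add_lt_top.mpr ⟨ENNReal.ofReal_lt_top, E.lintegral_sq_lt_top hφ⟩).ne
    have h1 : ∫⁻ x, ENNReal.ofReal ‖f x‖ ∂(E.scalarMeasure ψ φ).variation ≤
        ENNReal.ofReal (‖ψ‖ ^ 2) + ∫⁻ x, ‖f x‖ₑ ^ 2 ∂(E.scalarMeasure φ φ).variation := by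
      simp only [ofReal_norm]
      exact (E.lintegral_variation_le ψ φ _).trans
        (add_le_add (E.variation_self_univ_le ψ) le_rfl)
    have h2 := ENNReal.toReal_mono hfin h1
    rw [ENNReal.toReal_add ENNReal.ofReal_ne_top (E.lintegral_sq_lt_top hφ).ne,
      ENNReal.toReal_ofReal (by positivity)] at h2
    refine (VectorMeasure.norm_integral_le_lintegral_norm).trans ?_
    refine le_trans (mul_le_of_le_one_left ENNReal.toReal_nonneg ?_) h2
    exact ContinuousLinearMap.opNorm_lsmul_le
  have hb' : ∀ ψ, ‖L ψ‖ ≤ (1 + C) * ‖ψ‖ := fun ψ => by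
    by_cases h0 : ψ = 0
    · simp [h0]
    · have hn : 0 < ‖ψ‖ := norm_pos_iff.mpr h0
      have h1 := hb (((‖ψ‖⁻¹ : ℝ) : ℂ) • ψ)
      rw [map_smul, norm_smul, norm_smul, Complex.norm_real, norm_inv, norm_norm,
        inv_mul_cancel₀ hn.ne', one_pow, inv_mul_le_iff₀ hn] at h1
      linarith
  refine ⟨(InnerProductSpace.toDual ℂ H).symm (L.mkContinuous (1 + C) hb'), fun ψ => ?_⟩
  rw [← inner_conj_symm, InnerProductSpace.toDual_symm_apply, LinearMap.mkContinuous_apply, hL,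
    Complex.conj_conj]

/-- The operator integral `∫ f dE` of a real measurable function `f` on the square integrability
domain `{φ | ∫ f² dE_{φ,φ} < ∞}`: it sends `φ` to the unique vector satisfying
`⟪ψ, (∫ f dE) φ⟫ = ∫ f dE_{ψ,φ}` for all `ψ`. -/
noncomputable def sqIntegral [CompleteSpace H] (E : POVM Ω H) (f : Ω → ℝ) (hf : Measurable f) :
    H →ₗ.[ℂ] H where
  domain := E.sqDomain f
  toFun :=
    { toFun := fun φ => (E.exists_sqIntegral hf φ.2).choose
      map_add' := fun φ₁ φ₂ => by
        refine ext_inner_left ℂ fun ψ => ?_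
        rw [inner_add_right, (E.exists_sqIntegral hf (φ₁ + φ₂).2).choose_spec,
          (E.exists_sqIntegral hf φ₁.2).choose_spec, (E.exists_sqIntegral hf φ₂.2).choose_spec,
          Submodule.coe_add, scalarMeasure_add_right, VectorMeasure.integral_add_vectorMeasure
            (E.integrable_of_mem_sqDomain hf φ₁.2 ψ) (E.integrable_of_mem_sqDomain hf φ₂.2 ψ)]
      map_smul' := fun c φ => by
        refine ext_inner_left ℂ fun ψ => ?_
        rw [RingHom.id_apply, inner_smul_right, (E.exists_sqIntegral hf (c • φ).2).choose_spec,
          (E.exists_sqIntegral hf φ.2).choose_spec, Submodule.coe_smul, scalarMeasure_smul_right,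
          integral_smul_complexMeasure (E.integrable_of_mem_sqDomain hf φ.2 ψ)] }

theorem inner_sqIntegral [CompleteSpace H] (E : POVM Ω H) {f : Ω → ℝ} (hf : Measurable f)
    (ψ : H) (φ : (E.sqIntegral f hf).domain) :
    ⟪ψ, E.sqIntegral f hf φ⟫_ℂ = ∫ᵛ x, f x ∂•(E.scalarMeasure ψ φ) :=
  (E.exists_sqIntegral hf φ.2).choose_spec ψ

/-- The compression `X ↦ U* E(X) U` of a POVM by an isometry `U`. -/
noncomputable def compress [CompleteSpace H] {K : Type*} [NormedAddCommGroup K]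
    [InnerProductSpace ℂ K] [CompleteSpace K] (E : POVM Ω K) (U : H →ₗᵢ[ℂ] K) : POVM Ω H where
  toFun X := ContinuousLinearMap.adjoint U.toContinuousLinearMap ∘L E.toFun X ∘L
    U.toContinuousLinearMap
  isPositive X hX := (E.isPositive X hX).adjoint_conj _
  not_measurable X hX := by simp [E.not_measurable X hX]
  hasSum X hX hd φ :=
    (E.hasSum X hX hd (U φ)).mapL (ContinuousLinearMap.adjoint U.toContinuousLinearMap)
  univ_eq_one := by
    refine ContinuousLinearMap.ext fun φ => ext_inner_left ℂ fun ψ => ?_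
    simp [E.univ_eq_one, ContinuousLinearMap.adjoint_inner_right]

end General

section Moments

variable {H : Type*} [NormedAddCommGroup H] [InnerProductSpace ℂ H] [CompleteSpace H]

/-- The `k`-th moment operator `∫ x^k dE(x)` of a POVM on the real line, on the square
integrability domain `{φ | ∫ x^{2k} dE_{φ,φ} < ∞}`. -/
noncomputable def sqMoment (E : POVM ℝ H) (k : ℕ) : H →ₗ.[ℂ] H :=
  E.sqIntegral (fun x => x ^ k) (measurable_id.pow_const k)

/-- The `k`-th variance form `(ψ, φ) ↦ ∫ x^{2k} dE_{ψ,φ} - ⟪Ẽ[k] ψ, Ẽ[k] φ⟫` on the domain of the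
`k`-th moment operator `Ẽ[k]`. -/
noncomputable def varianceForm (E : POVM ℝ H) (k : ℕ) (ψ φ : (E.sqMoment k).domain) : ℂ :=
  (∫ᵛ x, x ^ (2 * k) ∂•(E.scalarMeasure (ψ : H) (φ : H))) - ⟪E.sqMoment k ψ, E.sqMoment k φ⟫_ℂ

/-- A POVM on the real line is variance-free if, for every `k`, its `k`-th moment operator is
densely defined and its `k`-th variance form vanishes identically. -/
def IsVarianceFree (E : POVM ℝ H) : Prop :=
  ∀ k : ℕ, Dense ((E.sqMoment k).domain : Set H) ∧
    ∀ ψ φ : (E.sqMoment k).domain, E.varianceForm k ψ φ = 0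

end Moments

end POVM

/-- The Hilbert space `L²(ℝ)`. -/
abbrev L2Line : Type := Lp ℂ 2 (volume : Measure ℝ)

/-- Lebesgue measure on the interval `[0, ℓ]`. -/
noncomputable abbrev intervalMeasure (ℓ : ℝ) : Measure ℝ := volume.restrict (Set.Icc 0 ℓ)

/-- The Hilbert space `L²([0, ℓ])`. -/
abbrev L2Interval (ℓ : ℝ) : Type := Lp ℂ 2 (intervalMeasure ℓ)

theorem memLp_indicator_L2Line (X : Set ℝ) (hX : MeasurableSet X) (ψ : L2Line) :
    MemLp (X.indicator ψ) 2 (volume : Measure ℝ) := (Lp.memLp ψ).indicator hX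

/-- Multiplication by the characteristic function of a measurable set, as a linear map. -/
noncomputable def indicatorMulLin (X : Set ℝ) (hX : MeasurableSet X) : L2Line →ₗ[ℂ] L2Line where
  toFun ψ := (memLp_indicator_L2Line X hX ψ).toLp (X.indicator ψ)
  map_add' ψ₁ ψ₂ := by
    refine Lp.ext ?_
    filter_upwards [Lp.coeFn_add ψ₁ ψ₂, MemLp.coeFn_toLp (memLp_indicator_L2Line X hX (ψ₁ + ψ₂)),
      MemLp.coeFn_toLp (memLp_indicator_L2Line X hX ψ₁), MemLp.coeFn_toLp (memLp_indicator_L2Line X hX ψ₂),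
      Lp.coeFn_add ((memLp_indicator_L2Line X hX ψ₁).toLp _) ((memLp_indicator_L2Line X hX ψ₂).toLp _)]
      with x h1 h2 h3 h4 h5
    rw [h5, Pi.add_apply, h2, h3, h4]
    by_cases h : x ∈ X
    · simp only [Set.indicator_of_mem h]
      exact h1
    · simp only [Set.indicator_of_notMem h, add_zero]
  map_smul' c ψ := by
    refine Lp.ext ?_
    filter_upwards [Lp.coeFn_smul c ψ, MemLp.coeFn_toLp (memLp_indicator_L2Line X hX (c • ψ)),
      MemLp.coeFn_toLp (memLp_indicator_L2Line X hX ψ),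
      Lp.coeFn_smul c ((memLp_indicator_L2Line X hX ψ).toLp _)] with x h1 h2 h3 h4
    rw [RingHom.id_apply, h4, Pi.smul_apply, h2, h3]
    by_cases h : x ∈ X
    · simp only [Set.indicator_of_mem h]
      exact h1
    · simp only [Set.indicator_of_notMem h, smul_zero]

theorem indicatorMulLin_coeFn (X : Set ℝ) (hX : MeasurableSet X) (ψ : L2Line) :
    indicatorMulLin X hX ψ =ᵐ[volume] X.indicator ψ :=
  MemLp.coeFn_toLp (memLp_indicator_L2Line X hX ψ)

/-- The bounded operator `ψ ↦ χ_X ψ` on `L²(ℝ)`. -/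
noncomputable def indicatorMul (X : Set ℝ) (hX : MeasurableSet X) : L2Line →L[ℂ] L2Line :=
  (indicatorMulLin X hX).mkContinuous 1 fun ψ => by
    rw [one_mul]
    refine Lp.norm_le_norm_of_ae_le ?_
    filter_upwards [indicatorMulLin_coeFn X hX ψ] with x hx
    rw [hx]
    exact norm_indicator_le_norm_self _ _

theorem indicatorMul_coeFn (X : Set ℝ) (hX : MeasurableSet X) (ψ : L2Line) :
    indicatorMul X hX ψ =ᵐ[volume] X.indicator ψ := indicatorMulLin_coeFn X hX ψ

theorem inner_indicatorMul (X : Set ℝ) (hX : MeasurableSet X) (ψ φ : L2Line) :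
    ⟪ψ, indicatorMul X hX φ⟫_ℂ = ∫ x in X, ⟪ψ x, φ x⟫_ℂ := by
  rw [L2.inner_def, ← integral_indicator hX]
  refine integral_congr_ae ?_
  filter_upwards [indicatorMul_coeFn X hX φ] with x hx
  rw [hx]
  by_cases h : x ∈ X <;> simp [h]

theorem indicatorMul_isPositive (X : Set ℝ) (hX : MeasurableSet X) :
    (indicatorMul X hX).IsPositive := by
  have hre : ∀ φ : L2Line, ⟪φ, indicatorMul X hX φ⟫_ℂ = ((∫ x in X, ‖φ x‖ ^ 2 : ℝ) : ℂ) := by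
    intro φ
    rw [inner_indicatorMul, ← integral_complex_ofReal]
    refine integral_congr_ae (Filter.Eventually.of_forall fun x => ?_)
    simp
  refine (ContinuousLinearMap.isPositive_iff_complex _).mpr fun φ => ?_
  rw [← inner_conj_symm, hre]
  refine ⟨by simp, ?_⟩
  simp only [Complex.conj_ofReal, RCLike.re_to_complex, Complex.ofReal_re]
  exact integral_nonneg fun x => by positivity

theorem norm_indicatorMul_sq (X : Set ℝ) (hX : MeasurableSet X) (φ : L2Line) :
    ‖indicatorMul X hX φ‖ ^ 2 = ∫ x in X, ‖φ x‖ ^ 2 := by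
  rw [← inner_self_eq_norm_sq (𝕜 := ℂ), L2.inner_def, ← integral_indicator hX,
    RCLike.re_to_complex]
  have : ∫ x, ⟪indicatorMul X hX φ x, indicatorMul X hX φ x⟫_ℂ
      = ∫ x, ((X.indicator (fun x => ‖φ x‖ ^ 2) x : ℝ) : ℂ) := by
    refine integral_congr_ae ?_
    filter_upwards [indicatorMul_coeFn X hX φ] with x hx
    rw [hx]
    by_cases h : x ∈ X
    · simp [h]
    · simp [h]
  rw [this, integral_complex_ofReal, Complex.ofReal_re]

theorem indicatorMul_hasSum (X : ℕ → Set ℝ) (hX : ∀ i, MeasurableSet (X i))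
    (hd : Pairwise (Function.onFun Disjoint X)) (φ : L2Line) :
    HasSum (fun i => indicatorMul (X i) (hX i) φ)
      (indicatorMul (⋃ i, X i) (MeasurableSet.iUnion hX) φ) := by
  have hint : Integrable (fun x => ‖φ x‖ ^ 2) volume := (Lp.memLp φ).integrable_norm_pow (by simp)
  have hU : MeasurableSet (⋃ i, X i) := MeasurableSet.iUnion hX
  have hS : ∀ s : Finset ℕ, MeasurableSet (⋃ i ∈ s, X i) := fun s =>
    s.measurableSet_biUnion fun i _ => hX i
  have hfin : ∀ s : Finset ℕ, (⇑(∑ i ∈ s, indicatorMul (X i) (hX i) φ) : ℝ → ℂ) =ᵐ[volume]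
      (⋃ i ∈ s, X i).indicator φ := by
    intro s
    induction s using Finset.induction_on with
    | empty =>
      simp only [Finset.sum_empty, Finset.notMem_empty, Set.iUnion_of_empty, Set.iUnion_empty,
        Set.indicator_empty]
      exact Lp.coeFn_zero _ _ _
    | insert a s ha ih =>
      rw [Finset.sum_insert ha, Finset.set_biUnion_insert]
      have hdis : Disjoint (X a) (⋃ i ∈ s, X i) :=
        Set.disjoint_iUnion₂_right.mpr fun i hi => hd (by rintro rfl; exact ha hi)
      rw [Set.indicator_union_of_disjoint hdis]
      filter_upwards [Lp.coeFn_add (indicatorMul (X a) (hX a) φ)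
        (∑ i ∈ s, indicatorMul (X i) (hX i) φ), ih, indicatorMul_coeFn (X a) (hX a) φ]
        with x h1 h2 h3
      rw [h1, Pi.add_apply, h2, h3]
  have hdiff : ∀ s : Finset ℕ, ‖∑ i ∈ s, indicatorMul (X i) (hX i) φ
      - indicatorMul (⋃ i, X i) hU φ‖ ^ 2
        = (∫ x in (⋃ i, X i), ‖φ x‖ ^ 2) - ∑ i ∈ s, ∫ x in X i, ‖φ x‖ ^ 2 := by
    intro s
    have hsub : (⋃ i ∈ s, X i) ⊆ ⋃ i, X i := Set.iUnion₂_subset_iUnion _ _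
    have h1 : ‖∑ i ∈ s, indicatorMul (X i) (hX i) φ - indicatorMul (⋃ i, X i) hU φ‖
        = ‖indicatorMul ((⋃ i, X i) \ ⋃ i ∈ s, X i) (hU.diff (hS s)) φ‖ := by
      rw [← norm_neg]
      congr 1
      refine Lp.ext ?_
      filter_upwards [hfin s, indicatorMul_coeFn _ hU φ, indicatorMul_coeFn _ (hU.diff (hS s)) φ,
        Lp.coeFn_neg (∑ i ∈ s, indicatorMul (X i) (hX i) φ - indicatorMul (⋃ i, X i) hU φ),
        Lp.coeFn_sub (∑ i ∈ s, indicatorMul (X i) (hX i) φ) (indicatorMul (⋃ i, X i) hU φ)]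
        with x h1 h2 h3 h4 h5
      rw [h4, Pi.neg_apply, h5, Pi.sub_apply, h1, h2, h3]
      by_cases ha : x ∈ ⋃ i ∈ s, X i
      · rw [Set.indicator_of_mem ha, Set.indicator_of_mem (hsub ha),
          Set.indicator_of_notMem (s := (⋃ i, X i) \ ⋃ i ∈ s, X i) fun h => h.2 ha]
        simp
      · by_cases hb : x ∈ ⋃ i, X i
        · rw [Set.indicator_of_notMem ha, Set.indicator_of_mem hb,
            Set.indicator_of_mem (s := (⋃ i, X i) \ ⋃ i ∈ s, X i) ⟨hb, ha⟩]
          simp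
        · rw [Set.indicator_of_notMem ha, Set.indicator_of_notMem hb,
            Set.indicator_of_notMem (s := (⋃ i, X i) \ ⋃ i ∈ s, X i) fun h => hb h.1]
          simp
    rw [h1, norm_indicatorMul_sq, setIntegral_sdiff (hS s) hint.integrableOn hsub,
      integral_biUnion_finset s (fun i _ => hX i) (fun i _ j _ hij => hd hij)
        (fun i _ => hint.integrableOn)]
  have hlim := hasSum_integral_iUnion hX hd (hint.integrableOn (s := ⋃ i, X i))
  have h0 : Filter.Tendsto (fun s : Finset ℕ => ‖∑ i ∈ s, indicatorMul (X i) (hX i) φ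
      - indicatorMul (⋃ i, X i) hU φ‖ ^ 2) Filter.atTop (nhds 0) := by
    simp only [hdiff]
    have := (tendsto_const_nhds (x := ∫ x in (⋃ i, X i), ‖φ x‖ ^ 2)).sub hlim
    rw [sub_self] at this
    exact this
  refine tendsto_iff_norm_sub_tendsto_zero.mpr ?_
  have h1 := h0.sqrt
  simpa [Real.sqrt_sq] using h1

open Classical in
/-- The (sharp) position observable on `L²(ℝ)`: `(Q(X) ψ)(x) = χ_X(x) ψ(x)`. -/
noncomputable def positionPVM : POVM ℝ L2Line where
  toFun X := if hX : MeasurableSet X then indicatorMul X hX else 0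
  isPositive X hX := by
    rw [dif_pos hX]
    exact indicatorMul_isPositive X hX
  not_measurable X hX := by rw [dif_neg hX]
  hasSum X hX hd φ := by
    simp only [dif_pos (hX _), dif_pos (MeasurableSet.iUnion hX)]
    exact indicatorMul_hasSum X hX hd φ
  univ_eq_one := by
    rw [dif_pos MeasurableSet.univ]
    refine ContinuousLinearMap.ext fun ψ => Lp.ext ?_
    filter_upwards [indicatorMul_coeFn Set.univ MeasurableSet.univ ψ] with x hx
    rw [hx, Set.indicator_univ]
    rfl

theorem map_dilation : Measure.map (fun x : ℝ => (2 * Real.pi)⁻¹ * x) volume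
    = ENNReal.ofReal (2 * Real.pi) • (volume : Measure ℝ) := by
  rw [Real.map_volume_mul_left (by positivity), inv_inv, abs_of_pos (by positivity)]

theorem quasiMeasurePreserving_dilation :
    Measure.QuasiMeasurePreserving (fun x : ℝ => (2 * Real.pi)⁻¹ * x) volume volume :=
  ⟨by fun_prop, by rw [map_dilation]; exact Measure.smul_absolutelyContinuous⟩

theorem eLpNorm_dilation (ψ : L2Line) :
    eLpNorm (fun x : ℝ => (((√(2 * Real.pi))⁻¹ : ℝ) : ℂ) • ψ ((2 * Real.pi)⁻¹ * x)) 2 volume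
      = eLpNorm ψ 2 volume := by
  have h1 : eLpNorm (fun x : ℝ => ψ ((2 * Real.pi)⁻¹ * x)) 2 volume
      = ENNReal.ofReal (√(2 * Real.pi)) * eLpNorm ψ 2 volume := by
    have h := eLpNorm_map_measure (p := 2) (μ := (volume : Measure ℝ))
      (f := fun x : ℝ => (2 * Real.pi)⁻¹ * x) (g := ψ)
      (by rw [map_dilation]; exact (Lp.aestronglyMeasurable ψ).smul_measure _) (by fun_prop)
    rw [map_dilation, eLpNorm_smul_measure_of_ne_top (by simp), smul_eq_mul,
      ENNReal.ofReal_rpow_of_nonneg (by positivity) (by simp)] at h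
    rw [Real.sqrt_eq_rpow]
    simpa [Function.comp_def] using h.symm
  have h2 := eLpNorm_const_smul (((√(2 * Real.pi))⁻¹ : ℝ) : ℂ)
    (fun x : ℝ => ψ ((2 * Real.pi)⁻¹ * x)) 2 volume
  refine h2.trans ?_
  rw [h1, ← mul_assoc, ← ofReal_norm, Complex.norm_real, Real.norm_of_nonneg (by positivity),
    ← ENNReal.ofReal_mul (by positivity), inv_mul_cancel₀ (by positivity), ENNReal.ofReal_one,
    one_mul]

theorem memLp_dilation (ψ : L2Line) :
    MemLp (fun x : ℝ => (((√(2 * Real.pi))⁻¹ : ℝ) : ℂ) • ψ ((2 * Real.pi)⁻¹ * x)) 2 volume :=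
  ⟨((Lp.aestronglyMeasurable ψ).comp_quasiMeasurePreserving
    quasiMeasurePreserving_dilation).const_smul (((√(2 * Real.pi))⁻¹ : ℝ) : ℂ), by
      rw [eLpNorm_dilation]; exact Lp.eLpNorm_lt_top ψ⟩

/-- The unitary dilation `(D ψ)(x) = (2π)^{-1/2} ψ(x / 2π)` of `L²(ℝ)`. -/
noncomputable def dilation : L2Line →ₗᵢ[ℂ] L2Line where
  toFun ψ := (memLp_dilation ψ).toLp _
  map_add' ψ₁ ψ₂ := by
    refine Lp.ext ?_
    filter_upwards [quasiMeasurePreserving_dilation.ae (Lp.coeFn_add ψ₁ ψ₂),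
      MemLp.coeFn_toLp (memLp_dilation (ψ₁ + ψ₂)), MemLp.coeFn_toLp (memLp_dilation ψ₁),
      MemLp.coeFn_toLp (memLp_dilation ψ₂),
      Lp.coeFn_add ((memLp_dilation ψ₁).toLp _) ((memLp_dilation ψ₂).toLp _)] with x h1 h2 h3 h4 h5
    rw [h5, Pi.add_apply, h2, h3, h4, h1, Pi.add_apply, smul_add]
  map_smul' c ψ := by
    refine Lp.ext ?_
    filter_upwards [quasiMeasurePreserving_dilation.ae (Lp.coeFn_smul c ψ),
      MemLp.coeFn_toLp (memLp_dilation (c • ψ)), MemLp.coeFn_toLp (memLp_dilation ψ),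
      Lp.coeFn_smul c ((memLp_dilation ψ).toLp _)] with x h1 h2 h3 h4
    rw [RingHom.id_apply, h4, Pi.smul_apply, h2, h3, h1, Pi.smul_apply, smul_comm]
  norm_map' ψ := by
    change ‖(memLp_dilation ψ).toLp _‖ = ‖ψ‖
    rw [Lp.norm_toLp, Lp.norm_def, eLpNorm_dilation]

/-- The Fourier-Plancherel operator of `L²(ℝ)` in the normalization
`(F ψ)(x) = (2π)^{-1/2} ∫ e^{-ixt} ψ(t) dt`.  Mathlib's Fourier transform on `L²(ℝ)` is normalized
as `ξ ↦ ∫ e^{-2πiξt} ψ(t) dt`, so that it is composed with the dilation above. -/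
noncomputable def fourierPlancherel : L2Line →ₗᵢ[ℂ] L2Line :=
  dilation.comp (Lp.fourierTransformₗᵢ ℝ ℂ).toLinearIsometry

/-- The (sharp) momentum observable on `L²(ℝ)`: `P_ℝ(Y) = F* Q_ℝ(Y) F`. -/
noncomputable def momentumPVM : POVM ℝ L2Line := positionPVM.compress fourierPlancherel

theorem memLp_extendByZero (ℓ : ℝ) (φ : L2Interval ℓ) :
    MemLp ((Set.Icc 0 ℓ).indicator φ) 2 (volume : Measure ℝ) :=
  (memLp_indicator_iff_restrict measurableSet_Icc).mpr (Lp.memLp φ)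

/-- The isometry `U : L²([0, ℓ]) → L²(ℝ)` extending functions by zero. -/
noncomputable def extendByZero (ℓ : ℝ) : L2Interval ℓ →ₗᵢ[ℂ] L2Line where
  toFun φ := (memLp_extendByZero ℓ φ).toLp _
  map_add' φ₁ φ₂ := by
    refine Lp.ext ?_
    filter_upwards [(ae_restrict_iff' measurableSet_Icc).mp (Lp.coeFn_add φ₁ φ₂),
      MemLp.coeFn_toLp (memLp_extendByZero ℓ (φ₁ + φ₂)),
      MemLp.coeFn_toLp (memLp_extendByZero ℓ φ₁), MemLp.coeFn_toLp (memLp_extendByZero ℓ φ₂),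
      Lp.coeFn_add ((memLp_extendByZero ℓ φ₁).toLp _) ((memLp_extendByZero ℓ φ₂).toLp _)]
      with x h1 h2 h3 h4 h5
    rw [h5, Pi.add_apply, h2, h3, h4]
    by_cases h : x ∈ Set.Icc 0 ℓ
    · simp only [Set.indicator_of_mem h]
      exact h1 h
    · simp only [Set.indicator_of_notMem h, add_zero]
  map_smul' c φ := by
    refine Lp.ext ?_
    filter_upwards [(ae_restrict_iff' measurableSet_Icc).mp (Lp.coeFn_smul c φ),
      MemLp.coeFn_toLp (memLp_extendByZero ℓ (c • φ)),
      MemLp.coeFn_toLp (memLp_extendByZero ℓ φ),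
      Lp.coeFn_smul c ((memLp_extendByZero ℓ φ).toLp _)] with x h1 h2 h3 h4
    rw [RingHom.id_apply, h4, Pi.smul_apply, h2, h3]
    by_cases h : x ∈ Set.Icc 0 ℓ
    · simp only [Set.indicator_of_mem h]
      exact h1 h
    · simp only [Set.indicator_of_notMem h, smul_zero]
  norm_map' φ := by
    change ‖(memLp_extendByZero ℓ φ).toLp _‖ = ‖φ‖
    rw [Lp.norm_toLp, Lp.norm_def, eLpNorm_indicator_eq_eLpNorm_restrict measurableSet_Icc]

/-- The momentum POVM `P(Y) = U* P_ℝ(Y) U` of a particle confined to `[0, ℓ]`. -/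
noncomputable def momentumPOVM (ℓ : ℝ) : POVM ℝ (L2Interval ℓ) :=
  momentumPVM.compress (extendByZero ℓ)

/-- `g` is an absolutely continuous function on `[0, ℓ]`, vanishing at both endpoints, which
represents `φ`, and `-i g' = η` almost everywhere on `[0, ℓ]`. -/
def IsMomentumRep (ℓ : ℝ) (φ η : L2Interval ℓ) (g : ℝ → ℂ) : Prop :=
  φ =ᵐ[intervalMeasure ℓ] g ∧ AbsolutelyContinuousOnInterval g 0 ℓ ∧ g 0 = 0 ∧ g ℓ = 0 ∧
    ∀ᵐ x ∂(intervalMeasure ℓ), ∃ g' : ℂ, HasDerivAt g g' x ∧ η x = -Complex.I * g'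

theorem IsMomentumRep.add {ℓ : ℝ} {φ₁ φ₂ η₁ η₂ : L2Interval ℓ} {g₁ g₂ : ℝ → ℂ}
    (h₁ : IsMomentumRep ℓ φ₁ η₁ g₁) (h₂ : IsMomentumRep ℓ φ₂ η₂ g₂) :
    IsMomentumRep ℓ (φ₁ + φ₂) (η₁ + η₂) (g₁ + g₂) := by
  obtain ⟨a₁, b₁, c₁, d₁, e₁⟩ := h₁
  obtain ⟨a₂, b₂, c₂, d₂, e₂⟩ := h₂
  refine ⟨(Lp.coeFn_add φ₁ φ₂).trans (a₁.add a₂), b₁.add b₂, by simp [c₁, c₂], by simp [d₁, d₂], ?_⟩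
  filter_upwards [e₁, e₂, Lp.coeFn_add η₁ η₂] with x ⟨u, hu, hu'⟩ ⟨v, hv, hv'⟩ hx
  exact ⟨u + v, hu.add hv, by rw [hx, Pi.add_apply, hu', hv', mul_add]⟩

theorem IsMomentumRep.smul {ℓ : ℝ} {φ η : L2Interval ℓ} {g : ℝ → ℂ}
    (h : IsMomentumRep ℓ φ η g) (c : ℂ) :
    IsMomentumRep ℓ (c • φ) (c • η) (fun x => c • g x) := by
  obtain ⟨a, b, c', d, e⟩ := h
  refine ⟨(Lp.coeFn_smul c φ).trans (a.const_smul c), b.const_smul c, by simp [c'], by simp [d], ?_⟩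
  filter_upwards [e, Lp.coeFn_smul c η] with x ⟨u, hu, hu'⟩ hx
  exact ⟨c • u, hu.const_smul c, by rw [hx, Pi.smul_apply, hu', smul_eq_mul, smul_eq_mul]; ring⟩

theorem IsMomentumRep.unique {ℓ : ℝ} {φ η₁ η₂ : L2Interval ℓ} {g₁ g₂ : ℝ → ℂ}
    (h₁ : IsMomentumRep ℓ φ η₁ g₁) (h₂ : IsMomentumRep ℓ φ η₂ g₂) : η₁ = η₂ := by
  obtain ⟨a₁, b₁, c₁, d₁, e₁⟩ := h₁
  obtain ⟨a₂, b₂, c₂, d₂, e₂⟩ := h₂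
  refine Lp.ext ?_
  have hle : volume.restrict (Set.Ioo 0 ℓ) ≤ intervalMeasure ℓ :=
    Measure.restrict_mono_set _ Set.Ioo_subset_Icc_self
  have hI : Set.Ioo 0 ℓ ⊆ Set.uIcc 0 ℓ :=
    Set.Ioo_subset_Icc_self.trans Set.Icc_subset_uIcc
  have heq : Set.EqOn g₁ g₂ (Set.Ioo 0 ℓ) :=
    Measure.eqOn_open_of_ae_eq (ae_mono hle (a₁.symm.trans a₂)) isOpen_Ioo
      (b₁.continuousOn.mono hI) (b₂.continuousOn.mono hI)
  have hmem : ∀ᵐ x ∂(intervalMeasure ℓ), x ∈ Set.Ioo 0 ℓ := by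
    rw [intervalMeasure, ← restrict_Ioo_eq_restrict_Icc]
    exact ae_restrict_mem measurableSet_Ioo
  filter_upwards [e₁, e₂, hmem] with x ⟨u, hu, hu'⟩ ⟨v, hv, hv'⟩ hx
  have : u = v := hu.unique (hv.congr_of_eventuallyEq
    (Filter.eventuallyEq_of_mem (isOpen_Ioo.mem_nhds hx) heq))
  rw [hu', hv', this]

/-- The operator `P₀ = -i d/dx` in `L²([0, ℓ])`; its domain consists of the absolutely continuous
functions with derivative in `L²([0, ℓ])` which vanish at both endpoints. -/
noncomputable def momentumOp (ℓ : ℝ) : L2Interval ℓ →ₗ.[ℂ] L2Interval ℓ where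
  domain :=
    { carrier := {φ | ∃ η g, IsMomentumRep ℓ φ η g}
      zero_mem' := ⟨0, fun _ => 0, Lp.coeFn_zero _ _ _,
        ((LipschitzWith.const (0 : ℂ)).lipschitzOnWith).absolutelyContinuousOnInterval, rfl, rfl, by
          filter_upwards [Lp.coeFn_zero ℂ 2 (intervalMeasure ℓ)] with x hx
          exact ⟨0, hasDerivAt_const x 0, by rw [mul_zero]; exact hx⟩⟩
      add_mem' := fun ⟨η₁, g₁, h₁⟩ ⟨η₂, g₂, h₂⟩ => ⟨η₁ + η₂, g₁ + g₂, h₁.add h₂⟩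
      smul_mem' := fun c _ ⟨η, g, h⟩ => ⟨c • η, _, h.smul c⟩ }
  toFun :=
    { toFun := fun φ => φ.2.choose
      map_add' := fun φ₁ φ₂ =>
        (φ₁ + φ₂).2.choose_spec.choose_spec.unique
          (φ₁.2.choose_spec.choose_spec.add φ₂.2.choose_spec.choose_spec)
      map_smul' := fun c φ =>
        (c • φ).2.choose_spec.choose_spec.unique (φ.2.choose_spec.choose_spec.smul c) }

theorem momentumOp_spec (ℓ : ℝ) (φ : (momentumOp ℓ).domain) :
    ∃ g, IsMomentumRep ℓ φ (momentumOp ℓ φ) g := φ.2.choose_spec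

/-- The composition `S T` of (unbounded) operators with its natural domain
`{x ∈ dom T | T x ∈ dom S}`. -/
def LinearPMap.natComp {H : Type*} [AddCommGroup H] [Module ℂ H] (S T : H →ₗ.[ℂ] H) :
    H →ₗ.[ℂ] H where
  domain := (S.domain.comap T.toFun).map T.domain.subtype
  toFun :=
    { toFun := fun x => S ⟨T ⟨x, by
          obtain ⟨y, -, hy⟩ := x.2
          exact hy ▸ y.2⟩, by
          obtain ⟨x, y, hy, rfl⟩ := x
          exact hy⟩
      map_add' := fun x y => by
        rw [← LinearPMap.map_add]
        congr 1
        exact Subtype.ext (LinearPMap.map_add T ⟨x, _⟩ ⟨y, _⟩)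
      map_smul' := fun c x => by
        rw [RingHom.id_apply, ← LinearPMap.map_smul]
        congr 1
        exact Subtype.ext (LinearPMap.map_smul T c ⟨x, _⟩) }

/-- The powers `T^n` of an (unbounded) operator: `T^0` is the identity on the whole space and
`T^{n+1} = T T^n` on its natural domain. -/
def LinearPMap.natPow {H : Type*} [AddCommGroup H] [Module ℂ H] (T : H →ₗ.[ℂ] H) :
    ℕ → (H →ₗ.[ℂ] H)
  | 0 => LinearMap.toPMap LinearMap.id ⊤
  | n + 1 => LinearPMap.natComp T (LinearPMap.natPow T n)

/-- `g` is a representative of class `H^n([0, ℓ])` (`n ≥ 1`): it is `C^{n-1}` on `[0, ℓ]`, its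
`(n-1)`-th derivative is absolutely continuous, and its `n`-th derivative is in `L²([0, ℓ])`. -/
def IsSobolevRep (ℓ : ℝ) (n : ℕ) (g : ℝ → ℂ) : Prop :=
  ContDiffOn ℝ ((n - 1 : ℕ) : ℕ∞) g (Set.Icc 0 ℓ) ∧
    AbsolutelyContinuousOnInterval (iteratedDerivWithin (n - 1) g (Set.Icc 0 ℓ)) 0 ℓ ∧
    MemLp (iteratedDerivWithin n g (Set.Icc 0 ℓ)) 2 (intervalMeasure ℓ)

/-- The elements of the Sobolev space `H^n([0, ℓ])` (`n ≥ 1`) whose derivatives of orders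
`0, …, n - 1` vanish at both endpoints. -/
def sobolevZero (ℓ : ℝ) (n : ℕ) : Set (L2Interval ℓ) :=
  {φ | ∃ g : ℝ → ℂ, φ =ᵐ[intervalMeasure ℓ] g ∧ IsSobolevRep ℓ n g ∧
    ∀ k < n, iteratedDerivWithin k g (Set.Icc 0 ℓ) 0 = 0 ∧
      iteratedDerivWithin k g (Set.Icc 0 ℓ) ℓ = 0}

/-! Let V = F U (`intervalFourier`), an isometry of L²([0, ℓ]) into L²(ℝ). The complex measure
P_{ψ,φ} has density conj(Vψ) · Vφ with respect to Lebesgue measure. Hence φ lies in the domain of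
the n-th moment operator exactly when xⁿVφ is square integrable (`mem_sqMoment_domain_iff`). If
moreover xⁿVφ = Vη for some η, then the moment operator sends φ to η (`sqMoment_eq_of_ae_eq`), and
if this holds throughout the domain the variance form vanishes (`varianceForm_eq_zero`). Everything
therefore rests on one fact: square integrability of xⁿVφ already forces xⁿVφ into the range of V.

For n = 1, square integrability of xVφ says that the extension of φ by zero has a weak derivative in
L²(ℝ) (`isWeakMomentum_iff`, `exists_fourierPlancherel_ae_eq`). That derivative vanishes off [0, ℓ],
and φ is its primitive, which is absolutely continuous and zero at both endpoints
(`IsWeakMomentum.exists_isMomentumRep`). So φ belongs to the domain of P₀. Conversely, integration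
by parts without boundary terms gives V P₀φ = xVφ (`IsMomentumRep.intervalFourier_ae_eq`).

Induction on n yields the same description for P₀ⁿ (`natPow_momentumOp_spec`), hence the equality of
operators and the vanishing of the variance. A second induction, removing the innermost derivative,
identifies the domains with the Sobolev spaces. Density holds because smooth functions with compact
support in (0, ℓ) lie in every domain. -/

open scoped SchwartzMap FourierTransform ContDiff

/-! ### Integration against a complex measure with a density -/

namespace MeasureTheory.VectorMeasure

variable {X : Type*} [MeasurableSpace X]

/-- The integral of a real function with respect to a complex measure with a density. -/
theorem integral_withDensityᵥ {ν : Measure X} {k : X → ℂ} (hk : Integrable k ν) {f : X → ℝ}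
    (hf : Measurable f) (hfi : (ν.withDensityᵥ k).Integrable f) :
    ∫ᵛ x, f x ∂•(ν.withDensityᵥ k) = ∫ x, f x • k x ∂ν := by
  have hvar := Measure.variation_withDensityᵥ hk
  have hfin : IsFiniteMeasure (ν.withDensityᵥ k).variation := by
    rw [hvar]
    exact ⟨by simpa [HasFiniteIntegral] using hk.2⟩
  have hsi : ∀ s : SimpleFunc X ℝ, (ν.withDensityᵥ k).Integrable s := fun s =>
    s.integrable_of_isFiniteMeasure
  have hsk : ∀ s : SimpleFunc X ℝ, Integrable (fun x => s x • k x) ν := fun s => by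
    obtain ⟨C, hC⟩ := s.exists_forall_norm_le
    exact hk.bdd_smul C s.aestronglyMeasurable (Filter.Eventually.of_forall hC)
  have hs : ∀ s : SimpleFunc X ℝ,
      ∫ᵛ x, s x ∂•(ν.withDensityᵥ k) = ∫ x, s x • k x ∂ν := by
    intro s
    induction s using SimpleFunc.induction with
    | const c hA =>
      rename_i A
      have h1 : (⇑(SimpleFunc.piecewise A hA (SimpleFunc.const X c) (SimpleFunc.const X 0)))
          = A.indicator fun _ => c := by
        ext x; by_cases hx : x ∈ A <;> simp [hx]
      rw [h1, VectorMeasure.integral_indicator hA, VectorMeasure.setIntegral_const]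
      have h2 : (fun x => (A.indicator (fun _ => c) x : ℝ) • k x)
          = A.indicator fun x => c • k x := by
        ext x; by_cases hx : x ∈ A <;> simp [hx]
      rw [h2, MeasureTheory.integral_indicator hA, MeasureTheory.integral_smul,
        withDensityᵥ_apply hk hA]
      rfl
    | add _ hf hg =>
      rename_i f g _
      simp only [SimpleFunc.coe_add, Pi.add_apply, add_smul]
      rw [VectorMeasure.integral_fun_add (hsi f) (hsi g), hf, hg,
        MeasureTheory.integral_add (hsk f) (hsk g)]
  -- The variation of the measure with density `k` is |k| ν, so integrability of `f` against it is
  -- integrability of `f • k` against `ν`.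
  have hfk : Integrable (fun x => f x • k x) ν := by
    refine ⟨hf.aestronglyMeasurable.smul hk.1, ?_⟩
    have := hfi.2
    rw [HasFiniteIntegral, hvar,
      lintegral_withDensity_eq_lintegral_mul₀ hk.1.enorm hf.enorm.aemeasurable] at this
    simpa only [HasFiniteIntegral, enorm_smul, mul_comm, Pi.mul_apply] using this
  -- Approximation from base point 0 keeps the simple functions below 2|f|, so dominated convergence
  -- passes to the limit on both sides.
  set s : ℕ → SimpleFunc X ℝ := fun n => SimpleFunc.approxOn f hf Set.univ 0 (Set.mem_univ _) n
  have hlim : ∀ x, Filter.Tendsto (fun n => s n x) Filter.atTop (nhds (f x)) := fun x =>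
    SimpleFunc.tendsto_approxOn hf (Set.mem_univ _) (by simp)
  have hbd : ∀ n x, ‖s n x‖ ≤ ‖f x‖ + ‖f x‖ := fun n x =>
    SimpleFunc.norm_approxOn_zero_le hf (Set.mem_univ _) x n
  have h1 : Filter.Tendsto (fun n => ∫ᵛ x, s n x ∂•(ν.withDensityᵥ k)) Filter.atTop
      (nhds (∫ᵛ x, f x ∂•(ν.withDensityᵥ k))) :=
    VectorMeasure.tendsto_integral_of_dominated_convergence (fun x => ‖f x‖ + ‖f x‖)
      (fun n => (s n).aestronglyMeasurable) (hfi.norm.add hfi.norm)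
      (fun n => .of_forall (hbd n)) (.of_forall hlim)
  have h2 : Filter.Tendsto (fun n => ∫ x, s n x • k x ∂ν) Filter.atTop
      (nhds (∫ x, f x • k x ∂ν)) := by
    refine MeasureTheory.tendsto_integral_of_dominated_convergence
      (fun x => ‖f x • k x‖ + ‖f x • k x‖)
      (fun n => (hsk (s n)).1) (hfk.norm.add hfk.norm)
      (fun n => .of_forall fun x => ?_) (.of_forall fun x => (hlim x).smul_const _)
    rw [norm_smul, norm_smul, ← add_mul]
    exact mul_le_mul_of_nonneg_right (hbd n x) (norm_nonneg _)
  simp only [hs] at h1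
  exact tendsto_nhds_unique h1 h2

end MeasureTheory.VectorMeasure

/-! ### The momentum POVM in Fourier space -/

theorem positionPVM_scalarMeasure (ψ φ : L2Line) :
    positionPVM.scalarMeasure ψ φ
      = (volume : Measure ℝ).withDensityᵥ fun x => ⟪ψ x, φ x⟫_ℂ := by
  ext X hX
  rw [withDensityᵥ_apply (L2.integrable_inner ψ φ) hX, POVM.scalarMeasure_apply,
    ← inner_indicatorMul X hX]
  simp only [positionPVM, dif_pos hX]

theorem POVM.compress_scalarMeasure {Ω H K : Type*} [MeasurableSpace Ω] [NormedAddCommGroup H]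
    [InnerProductSpace ℂ H] [CompleteSpace H] [NormedAddCommGroup K] [InnerProductSpace ℂ K]
    [CompleteSpace K] (E : POVM Ω K) (U : H →ₗᵢ[ℂ] K) (ψ φ : H) :
    (E.compress U).scalarMeasure ψ φ = E.scalarMeasure (U ψ) (U φ) := by
  ext X hX
  simp [POVM.scalarMeasure_apply, POVM.compress, ContinuousLinearMap.adjoint_inner_right]

/-- The isometry `L²([0, ℓ]) → L²(ℝ)` which diagonalizes the momentum POVM. -/
noncomputable def intervalFourier (ℓ : ℝ) : L2Interval ℓ →ₗᵢ[ℂ] L2Line :=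
  fourierPlancherel.comp (extendByZero ℓ)

theorem momentumPOVM_scalarMeasure (ℓ : ℝ) (ψ φ : L2Interval ℓ) :
    (momentumPOVM ℓ).scalarMeasure ψ φ = (volume : Measure ℝ).withDensityᵥ
      fun x => ⟪intervalFourier ℓ ψ x, intervalFourier ℓ φ x⟫_ℂ := by
  rw [momentumPOVM, POVM.compress_scalarMeasure, momentumPVM, POVM.compress_scalarMeasure,
    positionPVM_scalarMeasure]
  rfl

/-- The diagonal measure has the nonnegative density |Vφ|², so its variation has this same density
and integrability of x²ⁿ becomes that of |xⁿVφ|². -/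
theorem mem_sqMoment_domain_iff (ℓ : ℝ) (n : ℕ) (φ : L2Interval ℓ) :
    φ ∈ ((momentumPOVM ℓ).sqMoment n).domain ↔
      MemLp (fun x : ℝ => ((x ^ n : ℝ) : ℂ) * intervalFourier ℓ φ x) 2 volume := by
  have hm : AEStronglyMeasurable (intervalFourier ℓ φ) volume := Lp.aestronglyMeasurable _
  have hk := L2.integrable_inner (𝕜 := ℂ) (intervalFourier ℓ φ) (intervalFourier ℓ φ)
  have hm2 : AEStronglyMeasurable
      (fun x : ℝ => ((x ^ n : ℝ) : ℂ) * intervalFourier ℓ φ x) volume :=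
    AEStronglyMeasurable.mul (by fun_prop) hm
  change φ ∈ (momentumPOVM ℓ).sqDomain _ ↔ _
  rw [POVM.mem_sqDomain, momentumPOVM_scalarMeasure, VectorMeasure.Integrable,
    Measure.variation_withDensityᵥ hk,
    memLp_two_iff_integrable_sq_norm hm2,
    integrable_withDensity_iff_integrable_smul₀' hk.1.enorm (by simp)]
  refine integrable_congr (.of_forall fun x => ?_)
  simp only [inner_self_eq_norm_sq_to_K, toReal_enorm, norm_mul, smul_eq_mul, norm_pow,
    Complex.norm_real, Real.norm_eq_abs, mul_pow, RCLike.norm_ofReal, abs_norm]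
  rw [← pow_mul |x| n 2, mul_comm n 2, pow_mul |x|, sq_abs, mul_comm, ← pow_mul, ← pow_mul,
    mul_comm n 2]

theorem integral_momentumPOVM (ℓ : ℝ) (ψ φ : L2Interval ℓ) {f : ℝ → ℝ} (hf : Measurable f)
    (hfi : ((momentumPOVM ℓ).scalarMeasure ψ φ).Integrable f) :
    ∫ᵛ x, f x ∂•((momentumPOVM ℓ).scalarMeasure ψ φ)
      = ∫ x, f x • ⟪intervalFourier ℓ ψ x, intervalFourier ℓ φ x⟫_ℂ := by
  rw [momentumPOVM_scalarMeasure] at hfi ⊢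
  exact VectorMeasure.integral_withDensityᵥ (L2.integrable_inner _ _) hf hfi

/-- In general the moment operator acts as V* xⁿ V. When xⁿVφ lies in the range of the isometry V,
applying V* amounts to inverting V there. -/
theorem sqMoment_eq_of_ae_eq {ℓ : ℝ} {n : ℕ} {φ η : L2Interval ℓ}
    (h : intervalFourier ℓ η =ᵐ[volume]
      fun x : ℝ => ((x ^ n : ℝ) : ℂ) * intervalFourier ℓ φ x)
    (hφ : φ ∈ ((momentumPOVM ℓ).sqMoment n).domain) :
    (momentumPOVM ℓ).sqMoment n ⟨φ, hφ⟩ = η := by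
  refine ext_inner_left ℂ fun ψ => ?_
  have h1 := (momentumPOVM ℓ).inner_sqIntegral (measurable_id.pow_const n) ψ ⟨φ, hφ⟩
  refine h1.trans ?_
  rw [integral_momentumPOVM ℓ ψ φ (measurable_id.pow_const n)
    ((momentumPOVM ℓ).integrable_of_mem_sqDomain (measurable_id.pow_const n) hφ ψ),
    ← (intervalFourier ℓ).inner_map_map, L2.inner_def]
  refine integral_congr_ae ?_
  filter_upwards [h] with x hx
  rw [hx]
  simp [RCLike.inner_apply]
  ring

/-- The variance form pairs the components of xⁿVψ and xⁿVφ orthogonal to the range of V; under the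
hypothesis both components are zero. -/
theorem varianceForm_eq_zero {ℓ : ℝ} {n : ℕ}
    (h : ∀ φ ∈ ((momentumPOVM ℓ).sqMoment n).domain, ∃ η, intervalFourier ℓ η =ᵐ[volume]
      fun x : ℝ => ((x ^ n : ℝ) : ℂ) * intervalFourier ℓ φ x)
    (ψ φ : ((momentumPOVM ℓ).sqMoment n).domain) :
    (momentumPOVM ℓ).varianceForm n ψ φ = 0 := by
  obtain ⟨η₁, h₁⟩ := h ψ ψ.2
  obtain ⟨η₂, h₂⟩ := h φ φ.2
  have hi := (momentumPOVM ℓ).integrable_sq_of_mem_sqDomain ψ.2 φ.2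
  have he : (fun x : ℝ => (x ^ n) ^ 2) = fun x : ℝ => x ^ (2 * n) := by
    ext x; rw [← pow_mul, mul_comm]
  rw [he] at hi
  rw [POVM.varianceForm, sub_eq_zero, integral_momentumPOVM ℓ ψ φ (by fun_prop) hi,
    sqMoment_eq_of_ae_eq h₁ ψ.2, sqMoment_eq_of_ae_eq h₂ φ.2,
    ← (intervalFourier ℓ).inner_map_map, L2.inner_def]
  refine integral_congr_ae ?_
  filter_upwards [h₁, h₂] with x hx₁ hx₂
  rw [hx₁, hx₂]
  simp [RCLike.inner_apply]
  ring

/-! ### Weak derivatives and the Fourier transform -/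

/-- `η = -i φ'` in the sense of distributions: `⟪-i s', φ⟫ = ⟪s, η⟫` for all Schwartz
functions `s`. -/
def IsWeakMomentum (φ η : L2Line) : Prop :=
  ∀ s : 𝓢(ℝ, ℂ), Complex.I * ∫ x, starRingEnd ℂ (deriv s x) * φ x
    = ∫ x, starRingEnd ℂ (s x) * η x

theorem inner_schwartz_toLp (s : 𝓢(ℝ, ℂ)) (φ : L2Line) :
    ⟪s.toLp 2, φ⟫_ℂ = ∫ x, starRingEnd ℂ (s x) * φ x := by
  rw [L2.inner_def]
  refine integral_congr_ae ?_
  filter_upwards [s.coeFn_toLp 2] with x hx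
  rw [hx, RCLike.inner_apply, mul_comm]

theorem integral_conj_schwartz_mul (s : 𝓢(ℝ, ℂ)) (φ : L2Line) :
    ∫ x, starRingEnd ℂ (s x) * φ x = ∫ y, starRingEnd ℂ (𝓕 s y) * (𝓕 φ : L2Line) y := by
  rw [← inner_schwartz_toLp, ← inner_schwartz_toLp, ← SchwartzMap.toLp_fourier_eq,
    Lp.inner_fourier_eq]

theorem fourier_schwartz_deriv (s : 𝓢(ℝ, ℂ)) (y : ℝ) :
    𝓕 (SchwartzMap.derivCLM ℂ ℂ s) y = (2 * Real.pi * Complex.I * y) * 𝓕 s y := by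
  rw [SchwartzMap.fourier_coe, SchwartzMap.fourier_coe]
  have h : (⇑(SchwartzMap.derivCLM ℂ ℂ s) : ℝ → ℂ) = deriv s := by
    ext x; exact SchwartzMap.derivCLM_apply ℂ s x
  rw [h, Real.fourier_deriv s.integrable s.differentiable
    (h ▸ (SchwartzMap.derivCLM ℂ ℂ s).integrable)]
  rfl

theorem integral_conj_schwartz_deriv_mul (s : 𝓢(ℝ, ℂ)) (φ : L2Line) :
    Complex.I * ∫ x, starRingEnd ℂ (deriv s x) * φ x
      = ∫ y, starRingEnd ℂ (𝓕 s y) * ((2 * Real.pi * y : ℝ) * (𝓕 φ : L2Line) y) := by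
  have h := integral_conj_schwartz_mul (SchwartzMap.derivCLM ℂ ℂ s) φ
  simp only [SchwartzMap.derivCLM_apply, fourier_schwartz_deriv] at h
  rw [h, ← integral_const_mul]
  refine integral_congr_ae (.of_forall fun y => ?_)
  simp only [map_mul, Complex.conj_I, Complex.conj_ofReal, map_ofNat]
  push_cast
  linear_combination -(2 * Real.pi * y * starRingEnd ℂ (𝓕 s y) * (𝓕 φ : L2Line) y) * Complex.I_sq

/-- By Plancherel both pairings move to the Fourier side, where the derivative becomes
multiplication by 2πiy. Since the Fourier transform maps the Schwartz space onto itself, the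
transformed test functions include all smooth compactly supported ones, which determine a locally
integrable function. -/
theorem isWeakMomentum_iff_fourier (φ η : L2Line) :
    IsWeakMomentum φ η ↔
      ∀ᵐ y : ℝ, ((2 * Real.pi * y : ℝ) : ℂ) * (𝓕 φ : L2Line) y = (𝓕 η : L2Line) y := by
  simp only [IsWeakMomentum, integral_conj_schwartz_deriv_mul, integral_conj_schwartz_mul _ η]
  constructor
  · intro h
    have hloc : ∀ ψ : L2Line, LocallyIntegrable ψ volume := fun ψ =>
      (Lp.memLp ψ).locallyIntegrable (by norm_num)
    refine ae_eq_of_integral_contDiff_smul_eq ?_ (hloc _) fun g hg hgs => ?_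
    · exact (hloc (𝓕 φ)).continuous_smul (g := fun y : ℝ => ((2 * Real.pi * y : ℝ) : ℂ))
        (by fun_prop)
    · have hgs' : HasCompactSupport fun x => (g x : ℂ) := hgs.comp_left Complex.ofReal_zero
      have hg' : ContDiff ℝ ∞ fun x => (g x : ℂ) := Complex.ofRealCLM.contDiff.comp hg
      -- The test function is chosen so that its Fourier transform is the prescribed bump `g`.
      have h1 := h (𝓕⁻ (hgs'.toSchwartzMap hg'))
      rw [FourierTransform.fourier_fourierInv_eq] at h1
      simpa [Complex.real_smul] using h1
  · intro h s
    refine integral_congr_ae ?_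
    filter_upwards [h] with y hy
    rw [hy]

theorem fourierPlancherel_coeFn (φ : L2Line) :
    fourierPlancherel φ =ᵐ[volume] fun x : ℝ =>
      (((√(2 * Real.pi))⁻¹ : ℝ) : ℂ) * (𝓕 φ : L2Line) ((2 * Real.pi)⁻¹ * x) :=
  MemLp.coeFn_toLp (memLp_dilation (𝓕 φ))

theorem map_two_pi_mul : Measure.map (fun x : ℝ => 2 * Real.pi * x) volume
    = ENNReal.ofReal (2 * Real.pi)⁻¹ • (volume : Measure ℝ) := by
  rw [Real.map_volume_mul_left (by positivity), abs_of_pos (by positivity)]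

theorem quasiMeasurePreserving_two_pi_mul :
    Measure.QuasiMeasurePreserving (fun x : ℝ => 2 * Real.pi * x) volume volume :=
  ⟨by fun_prop, by rw [map_two_pi_mul]; exact Measure.smul_absolutelyContinuous⟩

theorem fourierPlancherel_two_pi_mul (φ : L2Line) :
    ∀ᵐ y : ℝ, fourierPlancherel φ (2 * Real.pi * y)
      = (((√(2 * Real.pi))⁻¹ : ℝ) : ℂ) * (𝓕 φ : L2Line) y := by
  filter_upwards [quasiMeasurePreserving_two_pi_mul.ae (fourierPlancherel_coeFn φ)] with y hy
  rw [hy, inv_mul_cancel_left₀ (by positivity)]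

/-- The substitution x = 2πy turns the frequency multiplier 2πy of `𝓕` into multiplication by x; it
preserves null sets in both directions. -/
theorem isWeakMomentum_iff (φ η : L2Line) :
    IsWeakMomentum φ η ↔
      fourierPlancherel η =ᵐ[volume] fun x : ℝ => (x : ℂ) * fourierPlancherel φ x := by
  have hc : (((√(2 * Real.pi))⁻¹ : ℝ) : ℂ) ≠ 0 := by
    exact_mod_cast (by positivity : (√(2 * Real.pi))⁻¹ ≠ 0)
  rw [isWeakMomentum_iff_fourier]
  constructor
  · intro h
    filter_upwards [quasiMeasurePreserving_dilation.ae h, fourierPlancherel_coeFn φ,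
      fourierPlancherel_coeFn η] with x h1 h2 h3
    rw [h2, h3, ← h1, mul_inv_cancel_left₀ (by positivity)]
    ring
  · intro h
    filter_upwards [quasiMeasurePreserving_two_pi_mul.ae h, fourierPlancherel_two_pi_mul φ,
      fourierPlancherel_two_pi_mul η] with y h1 h2 h3
    rw [h2, h3] at h1
    refine mul_left_cancel₀ hc ?_
    rw [h1]
    ring

/-- This is where surjectivity of the Fourier transform on L²(ℝ) enters: the preimage is obtained
from `𝓕⁻` after undoing the dilation. -/
theorem exists_fourierPlancherel_ae_eq {φ : L2Line}
    (h : MemLp (fun x : ℝ => (x : ℂ) * fourierPlancherel φ x) 2 volume) :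
    ∃ η, fourierPlancherel η =ᵐ[volume] fun x : ℝ => (x : ℂ) * fourierPlancherel φ x := by
  have h1 : MemLp (fun y : ℝ => ((2 * Real.pi * y : ℝ) : ℂ) *
      fourierPlancherel φ (2 * Real.pi * y)) 2 volume := by
    refine MemLp.comp_of_map (f := fun x : ℝ => 2 * Real.pi * x)
      (g := fun x : ℝ => (x : ℂ) * fourierPlancherel φ x) ?_ (by fun_prop)
    rw [map_two_pi_mul]
    exact h.smul_measure (by simp)
  -- The factor √(2π) cancels the normalization (2π)^{-1/2} of `fourierPlancherel`.
  have h2 := h1.const_mul ((√(2 * Real.pi) : ℝ) : ℂ)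
  refine ⟨𝓕⁻ (h2.toLp _), (isWeakMomentum_iff φ _).mp ((isWeakMomentum_iff_fourier φ _).mpr ?_)⟩
  rw [FourierTransform.fourier_fourierInv_eq]
  filter_upwards [h2.coeFn_toLp, fourierPlancherel_two_pi_mul φ] with y h3 h4
  have hc : (((√(2 * Real.pi)) : ℝ) : ℂ) ≠ 0 := by
    exact_mod_cast (by positivity : √(2 * Real.pi) ≠ 0)
  rw [h3, h4]
  push_cast
  field_simp

/-! ### Complex-valued absolutely continuous functions -/

namespace AbsolutelyContinuousOnInterval

/-- Applied to the real part, the imaginary part and the inclusion of ℝ in ℂ, this carries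
real-valued results over to complex-valued functions. -/
theorem comp_lipschitzWith_one {X Y : Type*} [PseudoMetricSpace X] [PseudoMetricSpace Y]
    {f : ℝ → X} {a b : ℝ} (hf : AbsolutelyContinuousOnInterval f a b) {h : X → Y}
    (hh : LipschitzWith 1 h) : AbsolutelyContinuousOnInterval (fun x => h (f x)) a b := by
  refine squeeze_zero (fun t => Finset.sum_nonneg fun i _ => dist_nonneg) (fun t => ?_) hf
  exact Finset.sum_le_sum fun i _ => by simpa using hh.dist_le_mul _ _

theorem congr {X : Type*} [PseudoMetricSpace X] {f g : ℝ → X} {a b : ℝ}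
    (hf : AbsolutelyContinuousOnInterval f a b) (h : Set.EqOn f g (Set.uIcc a b)) :
    AbsolutelyContinuousOnInterval g a b := by
  rw [absolutelyContinuousOnInterval_iff] at hf ⊢
  intro ε hε
  obtain ⟨δ, hδ, H⟩ := hf ε hε
  refine ⟨δ, hδ, fun E hE hlt => ?_⟩
  convert H E hE hlt using 1
  refine Finset.sum_congr rfl fun i hi => ?_
  have := hE.1 i hi
  rw [h this.1, h this.2]

theorem re {f : ℝ → ℂ} {a b : ℝ} (hf : AbsolutelyContinuousOnInterval f a b) :
    AbsolutelyContinuousOnInterval (fun x => (f x).re) a b :=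
  hf.comp_lipschitzWith_one (LipschitzWith.of_dist_le_mul fun z w => by
    simpa [Complex.dist_eq, Real.dist_eq] using Complex.abs_re_le_norm (z - w))

theorem im {f : ℝ → ℂ} {a b : ℝ} (hf : AbsolutelyContinuousOnInterval f a b) :
    AbsolutelyContinuousOnInterval (fun x => (f x).im) a b :=
  hf.comp_lipschitzWith_one (LipschitzWith.of_dist_le_mul fun z w => by
    simpa [Complex.dist_eq, Real.dist_eq] using Complex.abs_im_le_norm (z - w))

theorem ofReal {f : ℝ → ℝ} {a b : ℝ} (hf : AbsolutelyContinuousOnInterval f a b) :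
    AbsolutelyContinuousOnInterval (fun x => (f x : ℂ)) a b :=
  hf.comp_lipschitzWith_one Complex.isometry_ofReal.lipschitz

theorem of_re_im {f : ℝ → ℂ} {a b : ℝ}
    (h₁ : AbsolutelyContinuousOnInterval (fun x => (f x).re) a b)
    (h₂ : AbsolutelyContinuousOnInterval (fun x => (f x).im) a b) :
    AbsolutelyContinuousOnInterval f a b :=
  (h₁.ofReal.add (h₂.ofReal.const_smul Complex.I)).congr fun x _ => by
    simp [mul_comm Complex.I, Complex.re_add_im]

theorem ae_differentiableAt_complex {f : ℝ → ℂ} {a b : ℝ}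
    (hf : AbsolutelyContinuousOnInterval f a b) :
    ∀ᵐ x : ℝ, x ∈ Set.uIcc a b → DifferentiableAt ℝ f x := by
  filter_upwards [hf.re.ae_differentiableAt, hf.im.ae_differentiableAt] with x h₁ h₂ hx
  have h : f = fun x => ((f x).re : ℂ) + (f x).im * Complex.I := by
    ext x; exact (Complex.re_add_im _).symm
  rw [h]
  exact ((h₁ hx).hasDerivAt.ofReal_comp.differentiableAt).add
    ((h₂ hx).hasDerivAt.ofReal_comp.differentiableAt.mul_const _)

end AbsolutelyContinuousOnInterval

theorem IntervalIntegrable.absolutelyContinuousOnInterval_integral_complex {f : ℝ → ℂ} {a b c : ℝ}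
    (h : IntervalIntegrable f volume a b) (hc : c ∈ Set.uIcc a b) :
    AbsolutelyContinuousOnInterval (fun x => ∫ t in c..x, f t) a b := by
  have hi : ∀ x ∈ Set.uIcc a b, IntervalIntegrable f volume c x := fun x hx =>
    h.mono_set (Set.uIcc_subset_uIcc hc hx)
  have h₁ : IntervalIntegrable (fun x => (f x).re) volume a b := ⟨h.1.re, h.2.re⟩
  have h₂ : IntervalIntegrable (fun x => (f x).im) volume a b := ⟨h.1.im, h.2.im⟩
  refine .of_re_im ((h₁.absolutelyContinuousOnInterval_intervalIntegral hc).congr fun x hx => ?_)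
    ((h₂.absolutelyContinuousOnInterval_intervalIntegral hc).congr fun x hx => ?_)
  · exact Complex.reCLM.intervalIntegral_comp_comm (hi x hx)
  · exact Complex.imCLM.intervalIntegral_comp_comm (hi x hx)

namespace AbsolutelyContinuousOnInterval

/-- The fundamental theorem of calculus for complex absolutely continuous functions. -/
theorem eq_add_integral {f f' : ℝ → ℂ} {a b : ℝ}
    (hf : AbsolutelyContinuousOnInterval f a b)
    (hd : ∀ᵐ x : ℝ, x ∈ Set.uIcc a b → HasDerivAt f (f' x) x)
    (hi : IntervalIntegrable f' volume a b) :
    ∀ x ∈ Set.uIcc a b, f x = f a + ∫ t in a..x, f' t := by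
  -- The difference of `f` and the primitive of `f'` is absolutely continuous with derivative zero
  -- almost everywhere, hence constant.
  have hac := hf.sub (hi.absolutelyContinuousOnInterval_integral_complex (c := a) (by simp))
  obtain ⟨C, hC⟩ := hac.const_of_ae_hasDerivAt_zero (by
    filter_upwards [hd, hi.ae_hasDerivAt_integral] with x h₁ h₂ hx
    simpa using (h₁ hx).sub (h₂ hx a (by simp)))
  intro x hx
  have h₁ := hC x hx
  have h₂ := hC a (by simp)
  simp only [Pi.sub_apply, intervalIntegral.integral_same, sub_zero] at h₁ h₂
  rw [h₂, ← h₁]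
  ring

/-- Integration by parts of a complex absolutely continuous function which vanishes at the
endpoints against a `C¹` function. -/
theorem integral_deriv_mul_eq_neg {f f' p p' : ℝ → ℂ} {a b : ℝ}
    (hf : AbsolutelyContinuousOnInterval f a b)
    (hd : ∀ᵐ x : ℝ, x ∈ Set.uIcc a b → HasDerivAt f (f' x) x)
    (hi : IntervalIntegrable f' volume a b) (ha : f a = 0) (hb : f b = 0)
    (hp : ∀ x, HasDerivAt p (p' x) x) (hp' : Continuous p') :
    ∫ x in a..b, p' x * f x = -∫ x in a..b, p x * f' x := by
  have hpc : ContDiff ℝ 1 p := by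
    rw [contDiff_one_iff_deriv, show deriv p = p' from funext fun x => (hp x).deriv]
    exact ⟨fun x => (hp x).differentiableAt, hp'⟩
  have hpa : AbsolutelyContinuousOnInterval p a b := hpc.contDiffOn.absolutelyContinuousOnInterval
  have h₁ : IntervalIntegrable (fun x => p' x * f x) volume a b :=
    (hp'.continuousOn.mul hf.continuousOn).intervalIntegrable
  have h₂ : IntervalIntegrable (fun x => p x * f' x) volume a b :=
    hi.continuousOn_mul hpc.continuous.continuousOn
  -- The fundamental theorem of calculus for the product p f, evaluated at `b`; both boundary values
  -- vanish because `f` does.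
  have h := (hpa.smul hf).eq_add_integral (f' := fun x => p' x * f x + p x * f' x) (by
    filter_upwards [hd] with x hx hxm
    exact (hp x).mul (hx hxm)) (h₁.add h₂) b (by simp)
  rw [intervalIntegral.integral_add h₁ h₂] at h
  simp only [Pi.smul_apply', smul_eq_mul, ha, hb, mul_zero, zero_add] at h
  exact eq_neg_of_add_eq_zero_left h.symm

end AbsolutelyContinuousOnInterval

/-! ### The domain of the momentum operator through weak derivatives -/

theorem extendByZero_coeFn (ℓ : ℝ) (φ : L2Interval ℓ) :
    extendByZero ℓ φ =ᵐ[volume] (Set.Icc 0 ℓ).indicator φ :=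
  MemLp.coeFn_toLp (memLp_extendByZero ℓ φ)

theorem integral_mul_extendByZero {ℓ : ℝ} (hℓ : 0 < ℓ) (c : ℝ → ℂ) (φ : L2Interval ℓ) :
    ∫ x, c x * extendByZero ℓ φ x = ∫ x in 0..ℓ, c x * φ x := by
  rw [intervalIntegral.integral_of_le hℓ.le, ← integral_Icc_eq_integral_Ioc,
    ← integral_indicator measurableSet_Icc]
  refine integral_congr_ae ?_
  filter_upwards [extendByZero_coeFn ℓ φ] with x hx
  rw [hx]
  by_cases h : x ∈ Set.Icc 0 ℓ <;> simp [h]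

theorem L2Interval.intervalIntegrable {ℓ : ℝ} (hℓ : 0 < ℓ) (φ : L2Interval ℓ) :
    IntervalIntegrable φ volume 0 ℓ := by
  rw [intervalIntegrable_iff_integrableOn_Icc_of_le hℓ.le]
  exact (Lp.memLp φ).integrable (by norm_num)

theorem ae_interval_iff {ℓ : ℝ} (hℓ : 0 < ℓ) {p : ℝ → Prop} :
    (∀ᵐ x ∂(intervalMeasure ℓ), p x) ↔ ∀ᵐ x : ℝ, x ∈ Set.uIcc 0 ℓ → p x := by
  rw [intervalMeasure, ae_restrict_iff' measurableSet_Icc, Set.uIcc_of_le hℓ.le]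

theorem IsMomentumRep.ae_hasDerivAt {ℓ : ℝ} (hℓ : 0 < ℓ) {φ η : L2Interval ℓ} {g : ℝ → ℂ}
    (h : IsMomentumRep ℓ φ η g) :
    ∀ᵐ x : ℝ, x ∈ Set.uIcc 0 ℓ → HasDerivAt g (Complex.I * η x) x := by
  refine (ae_interval_iff hℓ).mp (h.2.2.2.2.mono fun x ⟨g', hg, hη⟩ => ?_)
  rwa [hη, show Complex.I * (-Complex.I * g') = g' by linear_combination -g' * Complex.I_sq]

/-- The Dirichlet conditions at 0 and ℓ are what keeps the extension by zero from acquiring point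
masses in its derivative: they remove the boundary terms of the integration by parts. -/
theorem IsMomentumRep.isWeakMomentum {ℓ : ℝ} (hℓ : 0 < ℓ) {φ η : L2Interval ℓ} {g : ℝ → ℂ}
    (h : IsMomentumRep ℓ φ η g) :
    IsWeakMomentum (extendByZero ℓ φ) (extendByZero ℓ η) := by
  intro s
  rw [integral_mul_extendByZero hℓ, integral_mul_extendByZero hℓ]
  have h₁ := h.2.1.integral_deriv_mul_eq_neg (h.ae_hasDerivAt hℓ)
    ((L2Interval.intervalIntegrable hℓ η).const_mul Complex.I) h.2.2.1 h.2.2.2.1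
    (p := fun x => starRingEnd ℂ (s x)) (p' := fun x => starRingEnd ℂ (deriv s x))
    (fun x => (s.differentiable x).hasDerivAt.star)
    (Complex.continuous_conj.comp ((s.smooth 1).continuous_deriv le_rfl))
  have h₂ : ∫ x in 0..ℓ, starRingEnd ℂ (deriv s x) * φ x
      = ∫ x in 0..ℓ, starRingEnd ℂ (deriv s x) * g x := by
    refine intervalIntegral.integral_congr_ae ?_
    filter_upwards [(ae_interval_iff hℓ).mp h.1] with x hx hxm
    rw [hx (Set.uIoc_subset_uIcc hxm)]
  have h₃ : ∫ x in 0..ℓ, starRingEnd ℂ (s x) * (Complex.I * η x)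
      = Complex.I * ∫ x in 0..ℓ, starRingEnd ℂ (s x) * η x := by
    rw [← intervalIntegral.integral_const_mul]
    congr 1; ext x; ring
  rw [h₂, h₁, h₃, mul_neg, ← mul_assoc, Complex.I_mul_I]
  ring

theorem IsMomentumRep.intervalFourier_ae_eq {ℓ : ℝ} (hℓ : 0 < ℓ) {φ η : L2Interval ℓ} {g : ℝ → ℂ}
    (h : IsMomentumRep ℓ φ η g) :
    intervalFourier ℓ η =ᵐ[volume] fun x : ℝ => (x : ℂ) * intervalFourier ℓ φ x :=
  (isWeakMomentum_iff _ _).mp (h.isWeakMomentum hℓ)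

/-- The primitives of a smooth function agree on `[0, ℓ]` with Schwartz functions. -/
theorem exists_schwartz_primitive (ℓ : ℝ) {u : ℝ → ℝ} (hu : ContDiff ℝ ∞ u) (c : ℝ) :
    ∃ s : 𝓢(ℝ, ℂ), ∀ x ∈ Set.Icc 0 ℓ,
      s x = ((c + ∫ t in 0..x, u t : ℝ) : ℂ) ∧ deriv s x = (u x : ℂ) := by
  set p : ℝ → ℝ := fun x => c + ∫ t in 0..x, u t with hp
  have hpd : ∀ x, HasDerivAt p (u x) x := fun x =>
    (hu.continuous.integral_hasStrictDerivAt 0 x).hasDerivAt.const_add c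
  have hpc : ContDiff ℝ ∞ p := by
    rw [contDiff_infty_iff_deriv, show deriv p = u from funext fun x => (hpd x).deriv]
    exact ⟨fun x => (hpd x).differentiableAt, hu⟩
  -- The cutoff equals 1 on an open ball containing [0, ℓ], so derivatives, and not only values, are
  -- unchanged up to and including the endpoints.
  let χ : ContDiffBump (0 : ℝ) := ⟨|ℓ| + 1, |ℓ| + 2, by positivity, by linarith⟩
  have hs : ContDiff ℝ ∞ fun x => ((χ x * p x : ℝ) : ℂ) :=
    Complex.ofRealCLM.contDiff.comp (χ.contDiff.mul hpc)
  have hc : HasCompactSupport fun x => ((χ x * p x : ℝ) : ℂ) :=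
    (χ.hasCompactSupport.mul_right (f' := p)).comp_left Complex.ofReal_zero
  have hχ : ∀ x ∈ Metric.ball (0 : ℝ) (|ℓ| + 1), χ x = 1 := fun x hx =>
    χ.one_of_mem_closedBall (Metric.ball_subset_closedBall hx)
  refine ⟨hc.toSchwartzMap hs, fun x hx => ?_⟩
  have hxb : x ∈ Metric.ball (0 : ℝ) (|ℓ| + 1) := by
    rw [mem_ball_zero_iff, Real.norm_of_nonneg hx.1]
    linarith [hx.2, le_abs_self ℓ]
  have heq : (⇑(hc.toSchwartzMap hs) : ℝ → ℂ) =ᶠ[nhds x] fun x => (p x : ℂ) :=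
    Filter.eventuallyEq_of_mem (Metric.isOpen_ball.mem_nhds hxb) fun y hy => by
      simp [hχ y hy]
  exact ⟨heq.eq_of_nhds, heq.deriv_eq.trans (hpd x).ofReal_comp.deriv⟩

/-- Weak derivatives are local: a test function supported off [0, ℓ] has zero derivative on [0, ℓ],
and the extension of φ vanishes elsewhere. This keeps xVφ in the range of V. -/
theorem IsWeakMomentum.ae_eq_zero_of_notMem {ℓ : ℝ} {φ : L2Interval ℓ} {η : L2Line}
    (h : IsWeakMomentum (extendByZero ℓ φ) η) : ∀ᵐ x : ℝ, x ∈ (Set.Icc 0 ℓ)ᶜ → η x = 0 := by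
  refine isClosed_Icc.isOpen_compl.ae_eq_zero_of_integral_contDiff_smul_eq_zero
    (((Lp.memLp η).locallyIntegrable (by norm_num)).locallyIntegrableOn _)
    fun g hg hgs hgt => ?_
  have hgs' : HasCompactSupport fun x => (g x : ℂ) := hgs.comp_left Complex.ofReal_zero
  have hg' : ContDiff ℝ ∞ fun x => (g x : ℂ) := Complex.ofRealCLM.contDiff.comp hg
  have h1 := h (hgs'.toSchwartzMap hg')
  have h2 : ∫ x, starRingEnd ℂ (deriv (hgs'.toSchwartzMap hg') x) * extendByZero ℓ φ x = 0 := by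
    refine integral_eq_zero_of_ae ?_
    filter_upwards [extendByZero_coeFn ℓ φ] with x hx
    rw [hx]
    by_cases hxm : x ∈ Set.Icc 0 ℓ
    · have h0 : (⇑(hgs'.toSchwartzMap hg') : ℝ → ℂ) =ᶠ[nhds x] fun _ => 0 := by
        have := notMem_tsupport_iff_eventuallyEq.mp fun hx' => hgt hx' hxm
        exact this.mono fun y hy => by simp [hy]
      simp [h0.deriv_eq]
    · simp [hxm]
  rw [h2, mul_zero] at h1
  simpa [Complex.real_smul] using h1.symm

/-- The representative is the primitive `G` of iη starting at 0. Test functions need not vanish at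
the endpoints, since the weak identity holds on all of ℝ: a constant test function gives `G ℓ = 0`,
and primitives of arbitrary smooth functions give φ = `G` with no undetermined constant. -/
theorem IsWeakMomentum.exists_isMomentumRep {ℓ : ℝ} (hℓ : 0 < ℓ) {φ : L2Interval ℓ} {η : L2Line}
    (h : IsWeakMomentum (extendByZero ℓ φ) η) : ∃ η' g, IsMomentumRep ℓ φ η' g := by
  have hu : Set.uIcc 0 ℓ = Set.Icc 0 ℓ := Set.uIcc_of_le hℓ.le
  have hηm : MemLp η 2 (intervalMeasure ℓ) := (Lp.memLp η).restrict _
  set e : L2Interval ℓ := hηm.toLp η with he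
  have hη : extendByZero ℓ e = η := by
    refine Lp.ext ?_
    filter_upwards [extendByZero_coeFn ℓ e, h.ae_eq_zero_of_notMem,
      (ae_restrict_iff' measurableSet_Icc).mp hηm.coeFn_toLp] with x h1 h2 h3
    rw [h1]
    by_cases hx : x ∈ Set.Icc 0 ℓ
    · rw [Set.indicator_of_mem hx, h3 hx]
    · rw [Set.indicator_of_notMem hx, h2 hx]
  have hei := (L2Interval.intervalIntegrable hℓ e).const_mul Complex.I
  set G : ℝ → ℂ := fun x => ∫ t in 0..x, Complex.I * e t with hG
  have hGac : AbsolutelyContinuousOnInterval G 0 ℓ :=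
    hei.absolutelyContinuousOnInterval_integral_complex (by simp)
  have hGd : ∀ᵐ x : ℝ, x ∈ Set.uIcc 0 ℓ → HasDerivAt G (Complex.I * e x) x := by
    filter_upwards [hei.ae_hasDerivAt_integral] with x hx hxm
    exact hx hxm 0 (by simp)
  have hweak : ∀ u : ℝ → ℝ, ContDiff ℝ ∞ u → ∀ c : ℝ,
      Complex.I * ∫ x in 0..ℓ, (u x : ℂ) * φ x
        = ∫ x in 0..ℓ, ((c + ∫ t in 0..x, u t : ℝ) : ℂ) * e x := by
    intro u hu' c
    obtain ⟨s, hs⟩ := exists_schwartz_primitive ℓ hu' c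
    have h1 := h s
    rw [← hη, integral_mul_extendByZero hℓ, integral_mul_extendByZero hℓ] at h1
    rw [intervalIntegral.integral_congr (g := fun x => starRingEnd ℂ (deriv s x) * φ x)
      fun x hx => by simp [(hs x (hu ▸ hx)).2], h1]
    exact intervalIntegral.integral_congr fun x hx => by
      simp only [(hs x (hu ▸ hx)).1, Complex.conj_ofReal]
  have hG0 : G 0 = 0 := by simp [hG]
  have hGℓ : G ℓ = 0 := by
    -- With u = 0 and c = 1 the test function is 1 on [0, ℓ], so the integral of `e` over the
    -- interval is zero.
    have h1 := hweak (fun _ => 0) contDiff_const 1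
    simp only [Complex.ofReal_zero, zero_mul, intervalIntegral.integral_zero, mul_zero, add_zero,
      Complex.ofReal_one, one_mul] at h1
    rw [hG]
    simp only [intervalIntegral.integral_const_mul]
    rw [← h1, mul_zero]
  have hφi := L2Interval.intervalIntegrable hℓ φ
  have hGi : IntervalIntegrable G volume 0 ℓ := hGac.continuousOn.intervalIntegrable
  have hort : ∀ u : ℝ → ℝ, ContDiff ℝ ∞ u → ∫ x in 0..ℓ, (u x : ℂ) * (φ x - G x) = 0 := by
    intro u hu'
    -- The weak identity for φ and integration by parts for `G` are tested with the same primitive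
    -- of `u`, so their right-hand sides cancel.
    have h1 := hweak u hu' 0
    have h2 := hGac.integral_deriv_mul_eq_neg hGd hei hG0 hGℓ
      (p := fun x => ((0 + ∫ t in 0..x, u t : ℝ) : ℂ)) (p' := fun x => (u x : ℂ))
      (fun x => ((hu'.continuous.integral_hasStrictDerivAt 0 x).hasDerivAt.const_add
        (0 : ℝ)).ofReal_comp) (by have := hu'.continuous; fun_prop)
    have h3 : ∫ x in 0..ℓ, ((0 + ∫ t in 0..x, u t : ℝ) : ℂ) * (Complex.I * e x)
        = Complex.I * ∫ x in 0..ℓ, ((0 + ∫ t in 0..x, u t : ℝ) : ℂ) * e x := by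
      rw [← intervalIntegral.integral_const_mul]
      congr 1; ext x; ring
    have hc : Continuous fun x => (u x : ℂ) := by have := hu'.continuous; fun_prop
    simp only [mul_sub]
    rw [intervalIntegral.integral_sub (hφi.continuousOn_mul hc.continuousOn)
      (hGi.continuousOn_mul hc.continuousOn), h2, h3, ← h1, ← mul_assoc, Complex.I_mul_I]
    ring
  have hioo : ∀ᵐ x : ℝ, x ∈ Set.Ioo 0 ℓ → φ x - G x = 0 := by
    refine isOpen_Ioo.ae_eq_zero_of_integral_contDiff_smul_eq_zero (f := fun x => φ x - G x)
      ?_ fun g hg _ hgt => ?_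
    · refine IntegrableOn.locallyIntegrableOn ?_
      exact ((intervalIntegrable_iff_integrableOn_Ioo_of_le hℓ.le).mp (hφi.sub hGi))
    · rw [← hort g hg, intervalIntegral.integral_of_le hℓ.le,
        setIntegral_eq_integral_of_forall_compl_eq_zero]
      · rfl
      · intro x hx
        have : g x = 0 := image_eq_zero_of_notMem_tsupport fun hx' =>
          hx (Set.Ioo_subset_Ioc_self (hgt hx'))
        simp [this]
  refine ⟨e, G, ?_, hGac, hG0, hGℓ, ?_⟩
  · change ∀ᵐ x ∂(volume.restrict (Set.Icc 0 ℓ)), φ x = G x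
    rw [← restrict_Ioo_eq_restrict_Icc]
    refine (ae_restrict_iff' measurableSet_Ioo).mpr ?_
    filter_upwards [hioo] with x hx hxm
    exact sub_eq_zero.mp (hx hxm)
  · refine (ae_interval_iff hℓ).mpr ?_
    filter_upwards [hGd] with x hx hxm
    refine ⟨_, hx hxm, ?_⟩
    rw [neg_mul, ← mul_assoc, Complex.I_mul_I]
    ring

theorem exists_isMomentumRep {ℓ : ℝ} (hℓ : 0 < ℓ) {φ : L2Interval ℓ}
    (h : MemLp (fun x : ℝ => (x : ℂ) * intervalFourier ℓ φ x) 2 volume) :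
    ∃ η g, IsMomentumRep ℓ φ η g := by
  obtain ⟨η, hη⟩ := exists_fourierPlancherel_ae_eq h
  exact ((isWeakMomentum_iff _ _).mpr hη).exists_isMomentumRep hℓ

/-! ### Powers of the momentum operator as multiplication by powers of x -/

theorem LinearPMap.mem_natComp_domain {H : Type*} [AddCommGroup H] [Module ℂ H] {S T : H →ₗ.[ℂ] H}
    {x : H} : x ∈ (LinearPMap.natComp S T).domain ↔ ∃ h : x ∈ T.domain, T ⟨x, h⟩ ∈ S.domain := by
  constructor
  · rintro ⟨y, hy, rfl⟩
    exact ⟨y.2, hy⟩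
  · rintro ⟨h, hx⟩
    exact ⟨⟨x, h⟩, hx, rfl⟩

/-- The bound |x|ᵏ ≤ 1 + |x|ⁿ suffices. -/
theorem memLp_pow_mul_of_le {v : ℝ → ℂ} (hv : MemLp v 2 volume) {k n : ℕ} (hkn : k ≤ n)
    (h : MemLp (fun x : ℝ => ((x ^ n : ℝ) : ℂ) * v x) 2 volume) :
    MemLp (fun x : ℝ => ((x ^ k : ℝ) : ℂ) * v x) 2 volume := by
  refine (hv.norm.add h.norm).mono (AEStronglyMeasurable.mul (by fun_prop) hv.1)
    (.of_forall fun x => ?_)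
  have h1 : |x| ^ k ≤ 1 + |x| ^ n := by
    rcases le_total |x| 1 with hx | hx
    · have := pow_le_one₀ (n := k) (abs_nonneg x) hx
      have := pow_nonneg (abs_nonneg x) n
      linarith
    · have := pow_le_pow_right₀ hx hkn
      linarith
  simp only [norm_mul, Complex.norm_real, norm_pow, Real.norm_eq_abs, Pi.add_apply]
  refine le_trans ?_ (le_abs_self _)
  calc |x| ^ k * ‖v x‖ ≤ (1 + |x| ^ n) * ‖v x‖ := by gcongr
    _ = ‖v x‖ + |x| ^ n * ‖v x‖ := by ring

/-- Domain and action are proved in one induction: to decide whether P₀ⁿφ lies in the domain of P₀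
one needs xV(P₀ⁿφ), which the action at stage n identifies as xⁿ⁺¹Vφ. -/
theorem natPow_momentumOp_spec {ℓ : ℝ} (hℓ : 0 < ℓ) (n : ℕ) :
    (∀ φ, φ ∈ ((momentumOp ℓ).natPow n).domain ↔
      MemLp (fun x : ℝ => ((x ^ n : ℝ) : ℂ) * intervalFourier ℓ φ x) 2 volume) ∧
    ∀ φ : ((momentumOp ℓ).natPow n).domain,
      intervalFourier ℓ ((momentumOp ℓ).natPow n φ) =ᵐ[volume]
        fun x : ℝ => ((x ^ n : ℝ) : ℂ) * intervalFourier ℓ φ x := by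
  induction n with
  | zero =>
    refine ⟨fun φ => iff_of_true trivial (by simpa using Lp.memLp (intervalFourier ℓ φ)),
      fun φ => .of_forall fun x => ?_⟩
    simp only [pow_zero, Complex.ofReal_one, one_mul]
    rfl
  | succ n ih =>
    have key : ∀ φ : ((momentumOp ℓ).natPow (n + 1)).domain,
        intervalFourier ℓ ((momentumOp ℓ).natPow (n + 1) φ) =ᵐ[volume]
          fun x : ℝ => ((x ^ (n + 1) : ℝ) : ℂ) * intervalFourier ℓ φ x := by
      intro φ
      obtain ⟨h₁, h₂⟩ := LinearPMap.mem_natComp_domain.mp φ.2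
      obtain ⟨g, hg⟩ := momentumOp_spec ℓ ⟨_, h₂⟩
      filter_upwards [hg.intervalFourier_ae_eq hℓ, ih.2 ⟨φ, h₁⟩] with x hx₁ hx₂
      refine hx₁.trans ?_
      rw [hx₂]
      push_cast
      ring
    refine ⟨fun φ => ⟨fun h => (memLp_congr_ae (key ⟨φ, h⟩)).mp (Lp.memLp _), fun h => ?_⟩, key⟩
    have h₁ := (ih.1 φ).mpr (memLp_pow_mul_of_le (Lp.memLp _) n.le_succ h)
    refine LinearPMap.mem_natComp_domain.mpr ⟨h₁, ?_⟩
    refine exists_isMomentumRep hℓ ((memLp_congr_ae ?_).mp h)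
    filter_upwards [ih.2 ⟨φ, h₁⟩] with x hx
    rw [hx]
    push_cast
    ring

/-- `natPow` adds the new factor on the outside, whereas the Sobolev description differentiates the
function itself first. On the Fourier side the two orders agree, so the innermost factor can be
split off instead. -/
theorem mem_natPow_succ_domain_iff {ℓ : ℝ} (hℓ : 0 < ℓ) (n : ℕ) (φ : L2Interval ℓ) :
    φ ∈ ((momentumOp ℓ).natPow (n + 1)).domain ↔
      ∃ η g, IsMomentumRep ℓ φ η g ∧ η ∈ ((momentumOp ℓ).natPow n).domain := by
  have hc : ∀ {η g}, IsMomentumRep ℓ φ η g →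
      (fun x : ℝ => ((x ^ n : ℝ) : ℂ) * intervalFourier ℓ η x) =ᵐ[volume]
        fun x : ℝ => ((x ^ (n + 1) : ℝ) : ℂ) * intervalFourier ℓ φ x := by
    intro η g hg
    filter_upwards [hg.intervalFourier_ae_eq hℓ] with x hx
    rw [hx]
    push_cast
    ring
  rw [(natPow_momentumOp_spec hℓ (n + 1)).1]
  constructor
  · intro h
    have h₁ := memLp_pow_mul_of_le (k := 1) (Lp.memLp _) (by omega) h
    simp only [pow_one] at h₁
    obtain ⟨η, g, hg⟩ := exists_isMomentumRep hℓ h₁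
    exact ⟨η, g, hg, ((natPow_momentumOp_spec hℓ n).1 η).mpr ((memLp_congr_ae (hc hg)).mpr h)⟩
  · rintro ⟨η, g, hg, hη⟩
    exact (memLp_congr_ae (hc hg)).mp (((natPow_momentumOp_spec hℓ n).1 η).mp hη)

theorem sqMoment_momentumPOVM {ℓ : ℝ} (hℓ : 0 < ℓ) (n : ℕ) :
    (momentumPOVM ℓ).sqMoment n = (momentumOp ℓ).natPow n := by
  obtain ⟨h₁, h₂⟩ := natPow_momentumOp_spec hℓ n
  refine LinearPMap.ext ?_ fun φ hf hg => sqMoment_eq_of_ae_eq (h₂ ⟨φ, hg⟩) hf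
  ext φ
  rw [h₁, mem_sqMoment_domain_iff]

/-! ### Sobolev description of the domains -/

theorem memLp_intervalMeasure_of_continuousOn {ℓ : ℝ} {f : ℝ → ℂ}
    (hf : ContinuousOn f (Set.Icc 0 ℓ)) : MemLp f 2 (intervalMeasure ℓ) := by
  obtain ⟨C, hC⟩ := isCompact_Icc.exists_bound_of_continuousOn hf
  exact MemLp.of_bound (hf.aestronglyMeasurable measurableSet_Icc) C
    ((ae_restrict_iff' measurableSet_Icc).mpr (.of_forall hC))

theorem iteratedDerivWithin_fun_const_smul_eq (k : ℕ) (c : ℂ) (f : ℝ → ℂ) (s : Set ℝ) :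
    iteratedDerivWithin k (fun x => c • f x) s = fun x => c • iteratedDerivWithin k f s x :=
  funext fun _ => iteratedDerivWithin_const_smul_field c f

theorem L2Interval.ae_mem_Ioo (ℓ : ℝ) : ∀ᵐ x ∂(intervalMeasure ℓ), x ∈ Set.Ioo 0 ℓ := by
  rw [intervalMeasure, ← restrict_Ioo_eq_restrict_Icc]
  exact ae_restrict_mem measurableSet_Ioo

/-- An absolutely continuous function vanishing at the endpoints, with square integrable derivative,
is in the domain of the momentum operator. -/
theorem isMomentumRep_of_derivWithin {ℓ : ℝ} (hℓ : 0 < ℓ) {φ : L2Interval ℓ} {g : ℝ → ℂ}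
    (hφ : φ =ᵐ[intervalMeasure ℓ] g) (hg : AbsolutelyContinuousOnInterval g 0 ℓ) (h0 : g 0 = 0)
    (h1 : g ℓ = 0) {h : ℝ → ℂ} (hh : MemLp h 2 (intervalMeasure ℓ))
    (hgh : derivWithin g (Set.Icc 0 ℓ) =ᵐ[intervalMeasure ℓ] h) :
    IsMomentumRep ℓ φ ((hh.const_mul (-Complex.I)).toLp _) g := by
  refine ⟨hφ, hg, h0, h1, ?_⟩
  filter_upwards [(hh.const_mul (-Complex.I)).coeFn_toLp, L2Interval.ae_mem_Ioo ℓ, hgh,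
    (ae_interval_iff hℓ).mpr hg.ae_differentiableAt_complex] with x hx hxm hgx hd
  refine ⟨deriv g x, hd.hasDerivAt, ?_⟩
  rw [hx, ← hgx, derivWithin_of_mem_nhds (Icc_mem_nhds hxm.1 hxm.2)]

theorem IsMomentumRep.derivWithin_ae_eq {ℓ : ℝ} (hℓ : 0 < ℓ) {φ η : L2Interval ℓ} {g : ℝ → ℂ}
    (h : IsMomentumRep ℓ φ η g) :
    derivWithin g (Set.Icc 0 ℓ) =ᵐ[intervalMeasure ℓ] fun x => Complex.I * η x := by
  filter_upwards [L2Interval.ae_mem_Ioo ℓ, (ae_interval_iff hℓ).mpr (h.ae_hasDerivAt hℓ)]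
    with x hxm hd
  rw [derivWithin_of_mem_nhds (Icc_mem_nhds hxm.1 hxm.2), hd.deriv]

theorem mem_sobolevZero_one_iff {ℓ : ℝ} (hℓ : 0 < ℓ) (φ : L2Interval ℓ) :
    φ ∈ sobolevZero ℓ 1 ↔ ∃ η g, IsMomentumRep ℓ φ η g := by
  constructor
  · rintro ⟨g, hφ, ⟨-, hac, hm⟩, hb⟩
    have hb0 := hb 0 one_pos
    simp only [iteratedDerivWithin_zero] at hb0
    rw [iteratedDerivWithin_one] at hm
    exact ⟨_, g, isMomentumRep_of_derivWithin hℓ hφ (by simpa [iteratedDerivWithin_zero] using hac)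
      hb0.1 hb0.2 hm .rfl⟩
  · rintro ⟨η, g, h⟩
    refine ⟨g, h.1, ⟨?_, ?_, ?_⟩, fun k hk => ?_⟩
    · have := h.2.1.continuousOn
      rw [Set.uIcc_of_le hℓ.le] at this
      exact contDiffOn_zero.mpr this
    · simpa [iteratedDerivWithin_zero] using h.2.1
    · rw [iteratedDerivWithin_one]
      exact (memLp_congr_ae (h.derivWithin_ae_eq hℓ)).mpr ((Lp.memLp η).const_mul _)
    · obtain rfl : k = 0 := by omega
      simpa [iteratedDerivWithin_zero] using ⟨h.2.2.1, h.2.2.2.1⟩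

/-- One derivative is traded for one order of smoothness. Order one is treated separately because
there the derivative is only an L² class, while from order two on it has a continuous
representative. -/
theorem mem_sobolevZero_succ_iff {ℓ : ℝ} (hℓ : 0 < ℓ) (n : ℕ) (φ : L2Interval ℓ) :
    φ ∈ sobolevZero ℓ (n + 2) ↔ ∃ η g, IsMomentumRep ℓ φ η g ∧ η ∈ sobolevZero ℓ (n + 1) := by
  have hs : UniqueDiffOn ℝ (Set.Icc 0 ℓ) := uniqueDiffOn_Icc hℓ
  have hu : Set.uIcc 0 ℓ = Set.Icc 0 ℓ := Set.uIcc_of_le hℓ.le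
  have h0m : (0 : ℝ) ∈ Set.Icc 0 ℓ := ⟨le_rfl, hℓ.le⟩
  have hℓm : ℓ ∈ Set.Icc 0 ℓ := ⟨hℓ.le, le_rfl⟩
  constructor
  · rintro ⟨g, hφ, ⟨hc, hac, hm⟩, hb⟩
    change ContDiffOn ℝ ((n + 1 : ℕ) : ℕ∞) g _ at hc
    change AbsolutelyContinuousOnInterval (iteratedDerivWithin (n + 1) g _) 0 ℓ at hac
    have hc' : ContDiffOn ℝ (n + 1) g (Set.Icc 0 ℓ) := by exact_mod_cast hc
    obtain ⟨hd, -, hc''⟩ := (contDiffOn_succ_iff_derivWithin hs).mp hc'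
    have hgac : AbsolutelyContinuousOnInterval g 0 ℓ :=
      (hu ▸ hc'.of_le (by simp) : ContDiffOn ℝ 1 g (Set.uIcc 0 ℓ)).absolutelyContinuousOnInterval
    have hmem : MemLp (derivWithin g (Set.Icc 0 ℓ)) 2 (intervalMeasure ℓ) :=
      memLp_intervalMeasure_of_continuousOn hc''.continuousOn
    refine ⟨_, g, isMomentumRep_of_derivWithin hℓ hφ hgac (by simpa using (hb 0 (by omega)).1)
      (by simpa using (hb 0 (by omega)).2) hmem .rfl,
      fun x => -Complex.I • derivWithin g (Set.Icc 0 ℓ) x,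
      (hmem.const_mul (-Complex.I)).coeFn_toLp, ⟨?_, ?_, ?_⟩, fun k hk => ?_⟩
    · exact hc''.const_smul _
    · rw [iteratedDerivWithin_fun_const_smul_eq]
      refine (hac.const_smul (-Complex.I)).congr fun x hx => ?_
      rw [iteratedDerivWithin_succ']
      rfl
    · rw [iteratedDerivWithin_fun_const_smul_eq]
      rw [iteratedDerivWithin_succ'] at hm
      exact hm.const_smul (-Complex.I)
    · have hk' := hb (k + 1) (by omega)
      rw [iteratedDerivWithin_succ'] at hk'
      rw [iteratedDerivWithin_fun_const_smul_eq]
      simp [hk'.1, hk'.2]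
  · rintro ⟨η, g, hg, h, hη, ⟨hc, hac, hm⟩, hb⟩
    change ContDiffOn ℝ ((n : ℕ) : ℕ∞) h _ at hc
    change AbsolutelyContinuousOnInterval (iteratedDerivWithin n h _) 0 ℓ at hac
    -- `h` is controlled only on [0, ℓ]. Its extension by constants is continuous on ℝ, so its
    -- primitive is differentiable everywhere, in particular at the endpoints.
    have hcont := Continuous.Icc_extend' (h := hℓ.le) hc.continuousOn.domRestrict
    set H : ℝ → ℂ := Set.IccExtend hℓ.le ((Set.Icc 0 ℓ).domRestrict h) with hH
    have hHh : ∀ x ∈ Set.Icc 0 ℓ, H x = h x := fun x hx => by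
      rw [hH, Set.IccExtend_of_mem _ _ hx]; rfl
    -- Replacing η by its continuous representative turns the almost everywhere derivative of `g`
    -- into a pointwise one.
    have hgH : ∀ x ∈ Set.Icc 0 ℓ, g x = ∫ t in 0..x, Complex.I * H t := by
      have := hg.2.1.eq_add_integral (f' := fun x => Complex.I * H x) (by
        filter_upwards [hg.ae_hasDerivAt hℓ, (ae_interval_iff hℓ).mp hη] with x h₁ h₂ hx
        rw [hHh x (hu ▸ hx), ← h₂ hx]
        exact h₁ hx) ((by fun_prop : Continuous fun x => Complex.I * H x).intervalIntegrable _ _)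
      intro x hx
      rw [this x (hu ▸ hx), hg.2.2.1, zero_add]
    have hgd : ∀ x ∈ Set.Icc 0 ℓ, HasDerivWithinAt g (Complex.I * H x) (Set.Icc 0 ℓ) x := by
      intro x hx
      have hcI : Continuous fun x => Complex.I * H x := by fun_prop
      exact (hcI.integral_hasStrictDerivAt 0 x).hasDerivAt.hasDerivWithinAt.congr hgH (hgH x hx)
    have hder : Set.EqOn (derivWithin g (Set.Icc 0 ℓ)) (fun x => Complex.I • h x)
        (Set.Icc 0 ℓ) := fun x hx => by
      rw [(hgd x hx).derivWithin (hs x hx), hHh x hx]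
      rfl
    have hit : ∀ k, Set.EqOn (iteratedDerivWithin (k + 1) g (Set.Icc 0 ℓ))
        (fun x => Complex.I • iteratedDerivWithin k h (Set.Icc 0 ℓ) x) (Set.Icc 0 ℓ) := by
      intro k x hx
      rw [iteratedDerivWithin_succ', iteratedDerivWithin_congr hder hx,
        iteratedDerivWithin_fun_const_smul_eq]
    refine ⟨g, hg.1, ⟨?_, ?_, ?_⟩, fun k hk => ?_⟩
    · have : ContDiffOn ℝ (n + 1) g (Set.Icc 0 ℓ) :=
        (contDiffOn_succ_iff_derivWithin hs).mpr ⟨fun x hx => (hgd x hx).differentiableWithinAt,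
          by simp, (hc.const_smul Complex.I).congr hder⟩
      change ContDiffOn ℝ ((n + 1 : ℕ) : ℕ∞) g _
      exact_mod_cast this
    · exact (hac.const_smul Complex.I).congr fun x hx => (hit n (hu ▸ hx)).symm
    · refine (memLp_congr_ae ?_).mpr (hm.const_smul Complex.I)
      exact (ae_restrict_iff' measurableSet_Icc).mpr (.of_forall fun x hx => hit (n + 1) hx)
    · rcases k with _ | k
      · simpa [iteratedDerivWithin_zero] using ⟨hg.2.2.1, hg.2.2.2.1⟩
      · have := hb k (by omega)
        rw [hit k h0m, hit k hℓm]
        simp [this.1, this.2]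

theorem natPow_momentumOp_domain {ℓ : ℝ} (hℓ : 0 < ℓ) (n : ℕ) :
    (((momentumOp ℓ).natPow (n + 1)).domain : Set (L2Interval ℓ)) = sobolevZero ℓ (n + 1) := by
  induction n with
  | zero =>
    ext φ
    rw [SetLike.mem_coe, mem_natPow_succ_domain_iff hℓ, mem_sobolevZero_one_iff hℓ]
    exact ⟨fun ⟨η, g, h, _⟩ => ⟨η, g, h⟩, fun ⟨η, g, h⟩ => ⟨η, g, h, trivial⟩⟩
  | succ n ih =>
    ext φ
    rw [SetLike.mem_coe, mem_natPow_succ_domain_iff hℓ, mem_sobolevZero_succ_iff hℓ]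
    simp only [← ih, SetLike.mem_coe]

/-! ### Density of the domains and conclusion -/

/-- Differentiation preserves smoothness and does not enlarge the support, so the induction runs
over all such `g` at once. -/
theorem mem_natPow_domain_of_contDiff {ℓ : ℝ} (hℓ : 0 < ℓ) (n : ℕ) {φ : L2Interval ℓ} {g : ℝ → ℂ}
    (hφ : φ =ᵐ[intervalMeasure ℓ] g) (hg : ContDiff ℝ ∞ g) (hgs : tsupport g ⊆ Set.Ioo 0 ℓ) :
    φ ∈ ((momentumOp ℓ).natPow n).domain := by
  induction n generalizing φ g with
  | zero => trivial
  | succ n ih =>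
    have hd : ContDiff ℝ ∞ (deriv g) := (contDiff_infty_iff_deriv.mp hg).2
    have hmem : MemLp (deriv g) 2 (intervalMeasure ℓ) :=
      memLp_intervalMeasure_of_continuousOn hd.continuous.continuousOn
    have hz : ∀ x, x ∉ Set.Ioo 0 ℓ → g x = 0 := fun x hx =>
      image_eq_zero_of_notMem_tsupport fun h => hx (hgs h)
    refine (mem_natPow_succ_domain_iff hℓ n φ).mpr ⟨_, g, isMomentumRep_of_derivWithin hℓ hφ
      (hg.of_le (by simp)).contDiffOn.absolutelyContinuousOnInterval (hz 0 (by simp))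
      (hz ℓ (by simp)) hmem ?_, ih (hmem.const_mul (-Complex.I)).coeFn_toLp
        (contDiff_const.mul hd) ?_⟩
    · filter_upwards [L2Interval.ae_mem_Ioo ℓ] with x hxm
      rw [derivWithin_of_mem_nhds (Icc_mem_nhds hxm.1 hxm.2)]
    · exact ((closure_mono (Function.support_mul_subset_right _ _)).trans
        (tsupport_deriv_subset)).trans hgs

/-- A vector orthogonal to the domain is orthogonal to every test function on (0, ℓ), hence vanishes
almost everywhere there; the endpoints are a null set. -/
theorem dense_natPow_momentumOp_domain {ℓ : ℝ} (hℓ : 0 < ℓ) (n : ℕ) :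
    Dense (((momentumOp ℓ).natPow n).domain : Set (L2Interval ℓ)) := by
  rw [Submodule.dense_iff_topologicalClosure_eq_top, Submodule.topologicalClosure_eq_top_iff,
    Submodule.eq_bot_iff]
  intro ψ hψ
  have hint : Integrable ψ (intervalMeasure ℓ) := (Lp.memLp ψ).integrable (by norm_num)
  have hz : ∀ᵐ x : ℝ, x ∈ Set.Ioo 0 ℓ → ψ x = 0 := by
    refine isOpen_Ioo.ae_eq_zero_of_integral_contDiff_smul_eq_zero
      ((IntegrableOn.mono_set hint Set.Ioo_subset_Icc_self).locallyIntegrableOn)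
      fun g hg hgs hgt => ?_
    have hgc : ContDiff ℝ ∞ fun x => (g x : ℂ) := Complex.ofRealCLM.contDiff.comp hg
    have hmem : MemLp (fun x => (g x : ℂ)) 2 (intervalMeasure ℓ) :=
      memLp_intervalMeasure_of_continuousOn hgc.continuous.continuousOn
    have hsub : tsupport (fun x => (g x : ℂ)) ⊆ Set.Ioo 0 ℓ :=
      (closure_mono (Function.support_comp_subset Complex.ofReal_zero g)).trans hgt
    have h := (Submodule.mem_orthogonal _ _).mp hψ _
      (mem_natPow_domain_of_contDiff hℓ n hmem.coeFn_toLp hgc hsub)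
    rw [L2.inner_def] at h
    rw [← setIntegral_eq_integral_of_forall_compl_eq_zero (s := Set.Icc 0 ℓ), ← h]
    · refine integral_congr_ae ?_
      filter_upwards [hmem.coeFn_toLp] with x hx
      rw [hx, RCLike.inner_apply, Complex.real_smul]
      simp [mul_comm]
    · intro x hx
      have : g x = 0 := image_eq_zero_of_notMem_tsupport fun hx' =>
        hx (Set.Ioo_subset_Icc_self (hgt hx'))
      simp [this]
  refine Lp.ext ?_
  filter_upwards [L2Interval.ae_mem_Ioo ℓ, ae_restrict_of_ae hz,
    Lp.coeFn_zero ℂ 2 (intervalMeasure ℓ)] with x hx h1 h2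
  rw [h1 hx, h2]
  rfl

theorem mainTheorem5 (ℓ : ℝ) (hℓ : 0 < ℓ) :
    (∀ n : ℕ, (momentumPOVM ℓ).sqMoment n = (momentumOp ℓ).natPow n) ∧
    (∀ n : ℕ, 1 ≤ n → ((momentumOp ℓ).natPow n).domain = sobolevZero ℓ n) ∧
    (momentumPOVM ℓ).IsVarianceFree := by
  refine ⟨sqMoment_momentumPOVM hℓ, fun n hn => ?_, fun n => ⟨?_, varianceForm_eq_zero ?_⟩⟩
  · obtain ⟨m, rfl⟩ := Nat.exists_eq_add_of_le' hn
    exact natPow_momentumOp_domain hℓ m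
  · rw [sqMoment_momentumPOVM hℓ]
    exact dense_natPow_momentumOp_domain hℓ n
  · rw [sqMoment_momentumPOVM hℓ]
    exact fun φ hφ => ⟨_, (natPow_momentumOp_spec hℓ n).2 ⟨φ, hφ⟩⟩
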